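/- Fix $b\ge 2$, $\beta\ge 0$ and $h\in\mathbb R$. Let $\mathbb T^b$ be the infinite rooted tree in which every vertex has $b$ children, and for $m\ge 0$ let $T=T_m$ be the complete subtree of depth $m$ consisting of the vertices at distance at most $m$ from the root, with $n=(b^{m+1}-1)/(b-1)$ vertices; its boundary $\partial T$ is the set of children in $\mathbb T^b$ of its leaves. A boundary condition is a map $\tau:\partial T\to\{+1,-1,0\}$, where the value $0$ means that the boundary vertex is free (deleted), so that all-$0$ is the free boundary; all-$(+)$ means $\tau\equiv+1$. The Gibbs distribution of the Ising model on $T$ with boundary condition $\tau$ is the probability measure on $\{\pm1\}^T$ with $$\mu_T^\tau(\sigma)\propto\exp\Bigl[\beta\Bigl(\sum_{xy}\sigma_x\sigma_y+h\sum_{x\in T}\sigma_x\Bigr)\Bigr],$$ where the first sum is over the edges of $\mathbb T^b$ with at least one endpoint in $T$ and $\sigma=\tau$ on $\partial T$. The heat-bath Glauber dynamics is the continuous-time Markov chain on $\{\pm1\}^T$ in which $\sigma$ changes to $\sigma^x$ ($\sigma$ with the spin at $x$ flipped) at rate $c_x(\sigma)$, the conditional probability under $\mu_T^\tau$ of the spin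 $-\sigma_x$ at $x$ given the spins of $\sigma$ at all other vertices. Its spectral gap is $$c_{\rm gap}(\mu_T^\tau)=\inf_f\frac{\frac12\sum_{x\in T}\mu_T^\tau\bigl(c_x\,[f(\sigma^x)-f(\sigma)]^2\bigr)}{\mathrm{Var}_{\mu_T^\tau}(f)},$$ the infimum being over non-constant $f:\{\pm1\}^T\to\mathbb R$. Let $\beta_1=\frac12\log\frac{\sqrt b+1}{\sqrt b-1}$, and let $h_c(\beta)$ be the critical field, i.e. the supremum of $|h'|$ over all fields $h'\in\mathbb R$ for which the infinite-volume Gibbs measure (the probability measure on $\{\pm1\}^{\mathbb T^b}$ satisfying the DLR equations for inverse temperature $\beta$ and field $h'$) is not unique, and $h_c(\beta)=0$ if there is no such $h'$. Theorem. In each of the following situations there is a constant $c>0$, depending only on $b$, $\beta$ and $h$, such that the spectral gap of the heat-bath Glauber dynamics on $T_m$ is at least $c$ for every depth $m\ge0$ (hence independently of $n$). (i) $\beta<\beta_1$ ($h$ arbitrary) or $|h|>h_c(\beta)$ ($\beta$ arbitrary): the bound holds for every boundary condition $\tau$, with the same $c$ for all $\tau$. (ii) $\beta$ and $h$ are arbitrary: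 the bound holds for the all-$(+)$ boundary condition. -/

import Mathlib

noncomputable section

namespace IsingTree

open MeasureTheory
open scoped ENNReal

/-- Vertices of the infinite rooted `b`-ary tree: the root is `[]`, the children of `v` are the
lists `i :: v` with `i : Fin b`, and the parent of a vertex `w ≠ []` is `w.tail`. -/
abbrev Vertex (b : ℕ) : Type := List (Fin b)

/-- The complete `b`-ary tree of depth `m`: all vertices at distance at most `m` from the root. -/
def completeTree (b m : ℕ) : Finset (Vertex b) := (List.finite_length_le (Fin b) m).toFinset

/-- The edges of the infinite tree with at least one endpoint in `A`; the edge joining a non-root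
vertex `w` to its parent `w.tail` is represented by `w`. -/
def edgesMeeting {b : ℕ} (A : Finset (Vertex b)) : Finset (Vertex b) :=
  (A ∪ A.biUnion fun v => Finset.univ.image fun i : Fin b => i :: v).erase []

/-- Numerical value of a spin: `true` is `+1`, `false` is `-1`. -/
def spin (s : Bool) : ℝ := if s then 1 else -1

/-- Spin values on the whole tree: those of `σ` inside `A`, those of `η` outside `A`. -/
def spinValues {b : ℕ} (A : Finset (Vertex b)) (η : Vertex b → ℝ) (σ : A → Bool) : Vertex b → ℝ :=
  fun v => if hv : v ∈ A then spin (σ ⟨v, hv⟩) else η v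

/-- The Boltzmann weight
`exp (β (∑ s_x s_y + h ∑ s_x))`, the first sum over the edges `xy` meeting `A`,
the second over the vertices `x ∈ A`. -/
def weight {b : ℕ} (β h : ℝ) (A : Finset (Vertex b)) (s : Vertex b → ℝ) : ℝ :=
  Real.exp (β * (∑ w ∈ edgesMeeting A, s w * s w.tail + h * ∑ x ∈ A, s x))

/-- The probability of `σ` under the Gibbs distribution on `A` with boundary values `η`. -/
def gibbs {b : ℕ} (β h : ℝ) (A : Finset (Vertex b)) (η : Vertex b → ℝ) (σ : A → Bool) : ℝ :=
  weight β h A (spinValues A η σ) / ∑ ξ : A → Bool, weight β h A (spinValues A η ξ)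

/-! ### Infinite-volume Gibbs measures and the critical field -/

/-- The configuration on the infinite tree equal to `ξ` on `A` and to `ω` off `A`. -/
def glue {b : ℕ} (A : Finset (Vertex b)) (ω : Vertex b → Bool) (ξ : A → Bool) : Vertex b → Bool :=
  fun v => if hv : v ∈ A then ξ ⟨v, hv⟩ else ω v

/-- The Gibbs distribution on `A` given the configuration `ω` outside `A`, as a measure on the
configurations of the infinite tree. -/
def gibbsKernel {b : ℕ} (β h : ℝ) (A : Finset (Vertex b)) (ω : Vertex b → Bool) :
    Measure (Vertex b → Bool) :=
  ∑ ξ : A → Bool,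
    ENNReal.ofReal (gibbs β h A (fun v => spin (ω v)) ξ) • Measure.dirac (glue A ω ξ)

/-- The infinite-volume Gibbs measures of the Ising model on the infinite `b`-ary tree: the
probability measures satisfying the Dobrushin–Lanford–Ruelle equations for all finite sets. -/
def gibbsMeasures (b : ℕ) (β h : ℝ) : Set (Measure (Vertex b → Bool)) :=
  {ν | IsProbabilityMeasure ν ∧
    ∀ (A : Finset (Vertex b)) (E : Set (Vertex b → Bool)), MeasurableSet E →
      ∫⁻ ω, gibbsKernel β h A ω E ∂ν = ν E}

/-- The critical field: the supremum of `|h|` over the fields `h` for which the infinite-volume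
Gibbs measure is not unique (`0` if there is no such field). -/
def criticalField (b : ℕ) (β : ℝ) : ℝ≥0∞ :=
  ⨆ (h : ℝ) (_ : (gibbsMeasures b β h).Nontrivial), ENNReal.ofReal |h|

/-- The critical inverse temperature `β₁ = (1/2) log ((√b + 1) / (√b - 1))`. -/
def betaOne (b : ℕ) : ℝ := 1 / 2 * Real.log ((√(b : ℝ) + 1) / (√(b : ℝ) - 1))

/-! ### Heat-bath Glauber dynamics on the complete tree of depth `m`

A boundary condition `τ` assigns to each vertex just below the leaves a fixed spin `1` or `-1`,
or the value `0`, which means that this vertex is free, i.e. is deleted. Only the values of `τ`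
at those vertices matter. -/

variable {b : ℕ}

/-- All spin values seen by the configuration `σ` of the finite tree with boundary condition `τ`. -/
def withBoundary (m : ℕ) (τ : Vertex b → SignType) (σ : completeTree b m → Bool) :
    Vertex b → ℝ :=
  spinValues (completeTree b m) (fun v => (τ v : ℝ)) σ

/-- Expectation under the Gibbs distribution on the complete tree with boundary condition `τ`. -/
def expect (β h : ℝ) (m : ℕ) (τ : Vertex b → SignType) (f : (completeTree b m → Bool) → ℝ) : ℝ :=
  ∑ σ, gibbs β h (completeTree b m) (fun v => (τ v : ℝ)) σ * f σ

/-- Variance under the Gibbs distribution on the complete tree with boundary condition `τ`. -/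
def variance (β h : ℝ) (m : ℕ) (τ : Vertex b → SignType)
    (f : (completeTree b m → Bool) → ℝ) : ℝ :=
  expect β h m τ (fun σ => f σ ^ 2) - expect β h m τ f ^ 2

/-- The configuration `σ` with the spin at `x` flipped. -/
def flip {m : ℕ} (σ : completeTree b m → Bool) (x : completeTree b m) : completeTree b m → Bool :=
  Function.update σ x (!σ x)

/-- Heat-bath flip rate: the probability of the spin opposite to `σ x` at `x` under the Gibbs
distribution on `{x}` given all other spins of `σ` (and the boundary condition). -/
def flipRate (β h : ℝ) (m : ℕ) (τ : Vertex b → SignType) (x : completeTree b m)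
    (σ : completeTree b m → Bool) : ℝ :=
  gibbs β h {x.1} (withBoundary m τ σ) (fun _ => !σ x)

/-- Dirichlet form of the heat-bath dynamics, whose generator is
`(L f) σ = ∑ x, c_x σ * (f (σ^x) - f σ)`. -/
def dirichletForm (β h : ℝ) (m : ℕ) (τ : Vertex b → SignType)
    (f : (completeTree b m → Bool) → ℝ) : ℝ :=
  1 / 2 * ∑ x, expect β h m τ (fun σ => flipRate β h m τ x σ * (f (flip σ x) - f σ) ^ 2)

/-- The spectral gap: infimum of Dirichlet form over variance, over non-constant functions. -/
def spectralGap (β h : ℝ) (m : ℕ) (τ : Vertex b → SignType) : ℝ :=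
  ⨅ f : {f : (completeTree b m → Bool) → ℝ // ∃ σ σ', f σ ≠ f σ'},
    dirichletForm β h m τ f.1 / variance β h m τ f.1

end IsingTree

end

noncomputable section

namespace IsingTree

/-! ### Finite sums over spins, Gibbs averages, the tower property and conditional independence -/

section

open Finset

variable {b : ℕ}

/-! Write E_A for `gibbsAvg β h A`, the conditional expectation given the spins off A. These
operators are orthogonal projections in L² of the Gibbs distribution. By `inv_le_spectralGap` it
suffices to bound Var f by a constant, independent of the depth, times the sum over y of the mean
single-site variance of f at y; this is `poincare`.

Averaging out the tree from the leaves upwards bounds Var f by the sum over x of `siteVar`, the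
variance that the spin at x alone contributes in the subtree T below x
(`sqNorm_sub_le_sum_siteVar`). Let B be the top k + 1 levels of T and split f = (f - E_B f) + E_B f.
The first part costs single-site variances in B, with a constant depending only on the size of B
(`block_poincare`). Inside T, the second part is felt at x only through the spins k + 1 levels
below; if these are correlated with the spin at x by at most ε, it contributes at most ε times a sum
of site variances near x (`sqNorm_le_of_influence_le`, `siteVar_le`). Summed over x, that
contribution is absorbed in the left-hand side once (k + 2) ε is small.

The size of ε is a count of paths from x down to level k + 1 and back. Going down, the effect of the
spin at x is multiplied on each edge by at most κ, a bound for `influence` at the effective fields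
that really occur; going up, the posterior mean at x reacts by at most tanh β per edge, whatever the
spins. With b branches per level, ε is of order (b κ tanh β) ^ k, so b κ tanh β < 1 suffices. It is
enough to have the bound κ at a fixed distance from the boundary, since the last levels can be
treated as blocks (`exists_le_spectralGap`).

For β < β₁ the trivial κ = tanh β works. For the plus boundary the effective fields obey a
one-dimensional monotone recursion and decrease to a fixed point; its slope there, which is b times
the influence, cannot exceed 1, so b κ can be taken close to 1 and tanh β < 1 does the rest
(`exists_tendsto_homField_one`, `exists_influence_bound`). For |h| above the critical field,
uniqueness of the Gibbs measure makes the plus and minus fields converge to the same limit, and the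
fields of every boundary condition are squeezed between them (`tendsto_unique_of_not_nontrivial`).
-/

lemma spinValues_of_mem {A : Finset (Vertex b)} {v : Vertex b} (hv : v ∈ A) (s : Vertex b → ℝ)
    (ξ : A → Bool) : spinValues A s ξ v = spin (ξ ⟨v, hv⟩) := by
  simp [spinValues, hv]

lemma spinValues_of_notMem {A : Finset (Vertex b)} {v : Vertex b} (hv : v ∉ A) (s : Vertex b → ℝ)
    (ξ : A → Bool) : spinValues A s ξ v = s v := by
  simp [spinValues, hv]

lemma spinValues_congr {A : Finset (Vertex b)} {s s' : Vertex b → ℝ}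
    (hs : ∀ v ∉ A, s v = s' v) (ξ : A → Bool) : spinValues A s ξ = spinValues A s' ξ := by
  funext v
  by_cases hv : v ∈ A
  · rw [spinValues_of_mem hv, spinValues_of_mem hv]
  · rw [spinValues_of_notMem hv, spinValues_of_notMem hv, hs v hv]

/-- Sum of `f` over all spin configurations on `A`, the spins off `A` being those of `s`. -/
def sumOver (A : Finset (Vertex b)) (f : (Vertex b → ℝ) → ℝ) (s : Vertex b → ℝ) : ℝ :=
  ∑ ξ : A → Bool, f (spinValues A s ξ)

lemma sumOver_empty (f : (Vertex b → ℝ) → ℝ) (s : Vertex b → ℝ) : sumOver ∅ f s = f s := by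
  have h : ∀ ξ : (∅ : Finset (Vertex b)) → Bool, spinValues ∅ s ξ = s := fun ξ => by
    funext v; simp [spinValues]
  simp [sumOver, h]

lemma sumOver_singleton (y : Vertex b) (f : (Vertex b → ℝ) → ℝ) (s : Vertex b → ℝ) :
    sumOver {y} f s = f (Function.update s y 1) + f (Function.update s y (-1)) := by
  have h : ∀ ξ : ({y} : Finset (Vertex b)) → Bool,
      spinValues {y} s ξ = Function.update s y (spin (ξ ⟨y, by simp⟩)) := fun ξ => by
    funext v
    by_cases hv : v = y
    · subst hv; simp [spinValues]
    · simp [spinValues, hv]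
  unfold sumOver
  simp only [h]
  have e := Equiv.sum_comp (Equiv.funUnique ({y} : Finset (Vertex b)) Bool)
    (fun t => f (Function.update s y (spin t)))
  simp only [Equiv.funUnique_apply] at e
  refine Eq.trans ?_ (e.trans ?_)
  · rfl
  · simp [spin]

lemma sumOver_union {A C : Finset (Vertex b)} (hAC : Disjoint A C) (f : (Vertex b → ℝ) → ℝ)
    (s : Vertex b → ℝ) : sumOver (A ∪ C) f s = sumOver A (sumOver C f) s := by
  unfold sumOver
  rw [← Equiv.sum_comp (Equiv.piFinsetUnion (fun _ => Bool) hAC), Fintype.sum_prod_type]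
  refine Finset.sum_congr rfl fun ξ _ => Finset.sum_congr rfl fun ζ _ => ?_
  congr 1
  funext v
  by_cases hC : v ∈ C
  · rw [spinValues_of_mem hC, spinValues_of_mem (mem_union_right _ hC),
      Equiv.piFinsetUnion_right _ hAC hC (mem_union_right _ hC)]
  · rw [spinValues_of_notMem hC]
    by_cases hA : v ∈ A
    · rw [spinValues_of_mem hA, spinValues_of_mem (mem_union_left _ hA),
        Equiv.piFinsetUnion_left _ hAC hA (mem_union_left _ hA)]
    · rw [spinValues_of_notMem hA, spinValues_of_notMem (by simp [hA, hC])]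

lemma sumOver_congr_of_agree (A : Finset (Vertex b)) (f : (Vertex b → ℝ) → ℝ)
    {s s' : Vertex b → ℝ} (hs : ∀ v ∉ A, s v = s' v) : sumOver A f s = sumOver A f s' := by
  unfold sumOver
  simp only [spinValues_congr hs]

lemma sumOver_dependsOn {A : Finset (Vertex b)} {f : (Vertex b → ℝ) → ℝ} {U : Set (Vertex b)}
    (hf : DependsOn f (U ∪ A)) : DependsOn (sumOver A f) (U \ A) := by
  intro s s' hs
  refine Finset.sum_congr rfl fun ξ _ => hf fun v hv => ?_
  by_cases hA : v ∈ A
  · rw [spinValues_of_mem hA, spinValues_of_mem hA]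
  · rw [spinValues_of_notMem hA, spinValues_of_notMem hA]
    exact hs v ⟨hv.resolve_right hA, hA⟩

lemma dependsOn_spinValues {A : Finset (Vertex b)} {g : (Vertex b → ℝ) → ℝ}
    (hg : DependsOn g (A : Set (Vertex b))ᶜ) (s : Vertex b → ℝ) (ξ : A → Bool) :
    g (spinValues A s ξ) = g s :=
  hg fun _ hv => spinValues_of_notMem (by simpa using hv) _ _

lemma sumOver_mul_left {A : Finset (Vertex b)} {g : (Vertex b → ℝ) → ℝ}
    (hg : DependsOn g (A : Set (Vertex b))ᶜ) (f : (Vertex b → ℝ) → ℝ) (s : Vertex b → ℝ) :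
    sumOver A (fun s => g s * f s) s = g s * sumOver A f s := by
  simp only [sumOver, dependsOn_spinValues hg, Finset.mul_sum]

lemma sumOver_mul_right {A : Finset (Vertex b)} {g : (Vertex b → ℝ) → ℝ}
    (hg : DependsOn g (A : Set (Vertex b))ᶜ) (f : (Vertex b → ℝ) → ℝ) (s : Vertex b → ℝ) :
    sumOver A (fun s => f s * g s) s = sumOver A f s * g s := by
  simp only [sumOver, dependsOn_spinValues hg, Finset.sum_mul]

lemma sumOver_pos (A : Finset (Vertex b)) {f : (Vertex b → ℝ) → ℝ} (hf : ∀ s, 0 < f s)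
    (s : Vertex b → ℝ) : 0 < sumOver A f s :=
  Finset.sum_pos (fun _ _ => hf _) univ_nonempty

lemma weight_pos (β h : ℝ) (A : Finset (Vertex b)) (s : Vertex b → ℝ) : 0 < weight β h A s :=
  Real.exp_pos _

lemma mem_edgesMeeting {A : Finset (Vertex b)} {w : Vertex b} :
    w ∈ edgesMeeting A ↔ w ≠ [] ∧ (w ∈ A ∨ w.tail ∈ A) := by
  unfold edgesMeeting
  simp only [mem_erase, mem_union, mem_biUnion, mem_image, mem_univ, true_and]
  refine and_congr_right fun hw => or_congr_right ⟨?_, fun h => ?_⟩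
  · rintro ⟨v, hv, i, rfl⟩; simpa using hv
  · exact ⟨w.tail, h, w.head hw, by simp⟩

/-- Disjoint sets of vertices without an edge between them. -/
def Separated (A C : Finset (Vertex b)) : Prop :=
  Disjoint A C ∧ (∀ v ∈ A, v ≠ [] → v.tail ∉ C) ∧ (∀ v ∈ C, v ≠ [] → v.tail ∉ A)

lemma Separated.symm {A C : Finset (Vertex b)} (H : Separated A C) : Separated C A :=
  ⟨H.1.symm, H.2.2, H.2.1⟩

lemma Separated.mono {A C A' C' : Finset (Vertex b)} (H : Separated A C) (hA : A' ⊆ A)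
    (hC : C' ⊆ C) : Separated A' C' :=
  ⟨H.1.mono hA hC, fun v hv h0 hc => H.2.1 v (hA hv) h0 (hC hc),
    fun v hv h0 hc => H.2.2 v (hC hv) h0 (hA hc)⟩

/-- No edge that meets A has an endpoint in C. -/
lemma weight_dependsOn (β h : ℝ) {A C : Finset (Vertex b)} (H : Separated A C) :
    DependsOn (weight β h A) (C : Set (Vertex b))ᶜ := by
  intro s s' hs
  have hs' : ∀ v ∉ C, s v = s' v := fun v hv => hs v (by simpa using hv)
  have hA : ∀ v ∈ A, s v = s' v := fun v hv => hs' v (Finset.disjoint_left.1 H.1 hv)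
  unfold weight
  congr 3
  · refine Finset.sum_congr rfl fun w hw => ?_
    rw [mem_edgesMeeting] at hw
    rcases hw with ⟨h0, hw | hw⟩
    · rw [hA w hw, hs' _ (H.2.1 w hw h0)]
    · rw [hA _ hw, hs' w fun hc => H.2.2 w hc h0 hw]
  · rw [Finset.sum_congr rfl hA]

/-- The factor collects the energy terms of C that touch no vertex of A. Being constant in the spins
of A, it cancels from conditional laws on A, which is the consistency of the Gibbs specification. -/
lemma exists_weight_eq_mul (β h : ℝ) {A C : Finset (Vertex b)} (hAC : A ⊆ C) :
    ∃ g : (Vertex b → ℝ) → ℝ, (∀ s, 0 < g s) ∧ DependsOn g (A : Set (Vertex b))ᶜ ∧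
      ∀ s, weight β h C s = weight β h A s * g s := by
  have hE : edgesMeeting A ⊆ edgesMeeting C := fun w hw => by
    rw [mem_edgesMeeting] at hw ⊢
    exact ⟨hw.1, hw.2.imp (fun h => hAC h) fun h => hAC h⟩
  refine ⟨fun s => Real.exp (β * (∑ w ∈ edgesMeeting C \ edgesMeeting A, s w * s w.tail
    + h * ∑ x ∈ C \ A, s x)), fun s => Real.exp_pos _, ?_, fun s => ?_⟩
  · intro s s' hs
    have hs' : ∀ v ∉ A, s v = s' v := fun v hv => hs v (by simpa using hv)
    change Real.exp _ = Real.exp _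
    congr 3
    · refine Finset.sum_congr rfl fun w hw => ?_
      rw [mem_sdiff, mem_edgesMeeting, mem_edgesMeeting] at hw
      rw [hs' w (by tauto), hs' _ (by tauto)]
    · congr 1
      refine Finset.sum_congr rfl fun w hw => hs' w (by simp at hw; tauto)
  · unfold weight
    rw [← Real.exp_add, ← Finset.sum_sdiff hE, ← Finset.sum_sdiff hAC]
    congr 1; ring

/-- Expectation of `f` under the Gibbs distribution on `A` given the spins of `s` off `A`. -/
def gibbsAvg (β h : ℝ) (A : Finset (Vertex b)) (f : (Vertex b → ℝ) → ℝ) (s : Vertex b → ℝ) : ℝ :=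
  sumOver A (fun s => weight β h A s * f s) s / sumOver A (weight β h A) s

variable (β h : ℝ)

lemma gibbsAvg_eq_sum (A : Finset (Vertex b)) (f : (Vertex b → ℝ) → ℝ) (s : Vertex b → ℝ) :
    gibbsAvg β h A f s = ∑ ξ : A → Bool, gibbs β h A s ξ * f (spinValues A s ξ) := by
  simp only [gibbsAvg, gibbs, sumOver, Finset.sum_div]
  exact Finset.sum_congr rfl fun ξ _ => by ring

lemma gibbs_pos (A : Finset (Vertex b)) (s : Vertex b → ℝ) (ξ : A → Bool) :
    0 < gibbs β h A s ξ :=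
  div_pos (weight_pos ..) (Finset.sum_pos (fun _ _ => weight_pos ..) univ_nonempty)

lemma sum_gibbs (A : Finset (Vertex b)) (s : Vertex b → ℝ) :
    ∑ ξ : A → Bool, gibbs β h A s ξ = 1 := by
  simp only [gibbs, ← Finset.sum_div]
  exact div_self (Finset.sum_pos (fun _ _ => weight_pos ..) univ_nonempty).ne'

lemma gibbsAvg_of_factor {A : Finset (Vertex b)} {w g : (Vertex b → ℝ) → ℝ}
    (hg0 : ∀ s, 0 < g s) (hg : DependsOn g (A : Set (Vertex b))ᶜ)
    (hw : ∀ s, w s = weight β h A s * g s) (f : (Vertex b → ℝ) → ℝ) (s : Vertex b → ℝ) :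
    gibbsAvg β h A f s = sumOver A (fun s => w s * f s) s / sumOver A w s := by
  have e1 : sumOver A (fun s => w s * f s) s
      = sumOver A (fun s => weight β h A s * f s) s * g s := by
    rw [← sumOver_mul_right hg]; congr 1; funext s; rw [hw]; ring
  have e2 : sumOver A w s = sumOver A (weight β h A) s * g s := by
    rw [← sumOver_mul_right hg]; congr 1; funext s; rw [hw]
  rw [e1, e2, gibbsAvg, mul_div_mul_right _ _ (hg0 s).ne']

lemma gibbsAvg_eq_of_subset {A C : Finset (Vertex b)} (hAC : A ⊆ C) (f : (Vertex b → ℝ) → ℝ)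
    (s : Vertex b → ℝ) : gibbsAvg β h A f s =
      sumOver A (fun s => weight β h C s * f s) s / sumOver A (weight β h C) s := by
  obtain ⟨g, hg0, hg, hw⟩ := exists_weight_eq_mul β h hAC
  exact gibbsAvg_of_factor β h hg0 hg hw f s

lemma gibbsAvg_dependsOn (A : Finset (Vertex b)) (f : (Vertex b → ℝ) → ℝ) :
    DependsOn (gibbsAvg β h A f) (A : Set (Vertex b))ᶜ := by
  intro s s' hs
  have hs' : ∀ v ∉ A, s v = s' v := fun v hv => hs v (by simpa using hv)
  unfold gibbsAvg
  rw [sumOver_congr_of_agree A _ hs', sumOver_congr_of_agree A (weight β h A) hs']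

lemma gibbsAvg_mul_left {A : Finset (Vertex b)} {g : (Vertex b → ℝ) → ℝ}
    (hg : DependsOn g (A : Set (Vertex b))ᶜ) (f : (Vertex b → ℝ) → ℝ) (s : Vertex b → ℝ) :
    gibbsAvg β h A (fun s => g s * f s) s = g s * gibbsAvg β h A f s := by
  simp only [gibbsAvg_eq_sum, dependsOn_spinValues hg, Finset.mul_sum]
  exact Finset.sum_congr rfl fun ξ _ => by ring

lemma gibbsAvg_const (A : Finset (Vertex b)) (c : ℝ) (s : Vertex b → ℝ) :
    gibbsAvg β h A (fun _ => c) s = c := by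
  rw [gibbsAvg_eq_sum, ← Finset.sum_mul, sum_gibbs, one_mul]

lemma gibbsAvg_of_dependsOn {A : Finset (Vertex b)} {g : (Vertex b → ℝ) → ℝ}
    (hg : DependsOn g (A : Set (Vertex b))ᶜ) : gibbsAvg β h A g = g := by
  funext s
  have := gibbsAvg_mul_left β h hg (fun _ => 1) s
  simpa [gibbsAvg_const] using this

lemma gibbsAvg_empty (f : (Vertex b → ℝ) → ℝ) : gibbsAvg β h ∅ f = f :=
  gibbsAvg_of_dependsOn β h (by simpa using dependsOn_univ f)

lemma gibbsAvg_add (A : Finset (Vertex b)) (f g : (Vertex b → ℝ) → ℝ) (s : Vertex b → ℝ) :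
    gibbsAvg β h A (fun s => f s + g s) s = gibbsAvg β h A f s + gibbsAvg β h A g s := by
  simp only [gibbsAvg_eq_sum, mul_add, Finset.sum_add_distrib]

lemma gibbsAvg_sub (A : Finset (Vertex b)) (f g : (Vertex b → ℝ) → ℝ) (s : Vertex b → ℝ) :
    gibbsAvg β h A (fun s => f s - g s) s = gibbsAvg β h A f s - gibbsAvg β h A g s := by
  simp only [gibbsAvg_eq_sum, mul_sub, Finset.sum_sub_distrib]

lemma gibbsAvg_smul (A : Finset (Vertex b)) (c : ℝ) (f : (Vertex b → ℝ) → ℝ) (s : Vertex b → ℝ) :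
    gibbsAvg β h A (fun s => c * f s) s = c * gibbsAvg β h A f s := by
  simp only [gibbsAvg_eq_sum, Finset.mul_sum]
  exact Finset.sum_congr rfl fun ξ _ => by ring

lemma gibbsAvg_sum {κ : Type*} (I : Finset κ) (A : Finset (Vertex b))
    (f : κ → (Vertex b → ℝ) → ℝ) (s : Vertex b → ℝ) :
    gibbsAvg β h A (fun s => ∑ i ∈ I, f i s) s = ∑ i ∈ I, gibbsAvg β h A (f i) s := by
  simp only [gibbsAvg_eq_sum, Finset.mul_sum]
  exact Finset.sum_comm

lemma gibbsAvg_mono {A : Finset (Vertex b)} {f g : (Vertex b → ℝ) → ℝ} {s : Vertex b → ℝ}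
    (H : ∀ ξ : A → Bool, f (spinValues A s ξ) ≤ g (spinValues A s ξ)) :
    gibbsAvg β h A f s ≤ gibbsAvg β h A g s := by
  simp only [gibbsAvg_eq_sum]
  exact Finset.sum_le_sum fun ξ _ => mul_le_mul_of_nonneg_left (H ξ) (gibbs_pos ..).le

lemma gibbsAvg_nonneg {A : Finset (Vertex b)} {f : (Vertex b → ℝ) → ℝ} {s : Vertex b → ℝ}
    (H : ∀ ξ : A → Bool, 0 ≤ f (spinValues A s ξ)) : 0 ≤ gibbsAvg β h A f s := by
  rw [gibbsAvg_eq_sum]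
  exact Finset.sum_nonneg fun ξ _ => mul_nonneg (gibbs_pos ..).le (H ξ)

/-- The tower property of the Gibbs specification. -/
lemma gibbsAvg_gibbsAvg_of_subset {A C : Finset (Vertex b)} (hAC : A ⊆ C)
    (f : (Vertex b → ℝ) → ℝ) :
    gibbsAvg β h C (gibbsAvg β h A f) = gibbsAvg β h C f := by
  funext s
  have key : sumOver C (fun s => weight β h C s * gibbsAvg β h A f s) s
      = sumOver C (fun s => weight β h C s * f s) s := by
    -- Sum over A first: there the inner average is a constant, and it may be computed with the
    -- weight of C, so the normalisation cancels.
    rw [← Finset.sdiff_union_of_subset hAC, sumOver_union Finset.sdiff_disjoint,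
      sumOver_union Finset.sdiff_disjoint]
    rw [Finset.sdiff_union_of_subset hAC]
    congr 1
    funext s
    rw [sumOver_mul_right (gibbsAvg_dependsOn β h A f), gibbsAvg_eq_of_subset β h hAC,
      mul_div_cancel₀ _ (sumOver_pos A (weight_pos β h C) s).ne']
  rw [gibbsAvg, gibbsAvg, key]

lemma gibbsAvg_gibbsAvg_of_superset {A C : Finset (Vertex b)} (hAC : A ⊆ C)
    (f : (Vertex b → ℝ) → ℝ) :
    gibbsAvg β h A (gibbsAvg β h C f) = gibbsAvg β h C f :=
  gibbsAvg_of_dependsOn β h ((gibbsAvg_dependsOn β h C f).mono (by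
    simpa [Set.compl_subset_compl] using hAC))

/-- Conditional independence across separated sets. -/
lemma gibbsAvg_union {A C : Finset (Vertex b)} (H : Separated A C) (f : (Vertex b → ℝ) → ℝ) :
    gibbsAvg β h (A ∪ C) f = gibbsAvg β h A (gibbsAvg β h C f) := by
  funext s
  obtain ⟨g, hg0, hg, hw⟩ := exists_weight_eq_mul β h (A := C) (C := A ∪ C) subset_union_right
  obtain ⟨g', hg0', hg', hw'⟩ := exists_weight_eq_mul β h (A := A) (C := A ∪ C) subset_union_left
  have hAC := weight_dependsOn β h H
  have hCA := weight_dependsOn β h H.symm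
  -- Summing out C turns the joint weight into itself times Z_C / w_C, with Z_C the partition
  -- function of C and w_C its weight. Combined with the factor `g'`, this correction does not see
  -- the spins of A, by separation, so it cancels between numerator and denominator.
  have hS : ∀ f : (Vertex b → ℝ) → ℝ, sumOver C (fun s => weight β h (A ∪ C) s * f s)
      = fun s => weight β h (A ∪ C) s * gibbsAvg β h C f s *
        (sumOver C (weight β h C) s / weight β h C s) := by
    intro f
    funext s
    have : (fun s => weight β h (A ∪ C) s * f s)
        = fun s => g s * (weight β h C s * f s) := by funext s; rw [hw]; ring
    rw [this, sumOver_mul_left hg, gibbsAvg, hw]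
    have h1 := (sumOver_pos C (weight_pos β h C) s).ne'
    have h2 := (weight_pos β h C s).ne'
    field_simp
  have hindep : DependsOn (fun s => sumOver C (weight β h C) s / weight β h C s * g' s)
      (A : Set (Vertex b))ᶜ := by
    intro s s' hs
    have h3 : DependsOn (sumOver C (weight β h C)) (A : Set (Vertex b))ᶜ :=
      (sumOver_dependsOn (U := (A : Set (Vertex b))ᶜ)
        (hCA.mono (Set.subset_union_left))).mono Set.sdiff_subset
    simp only [h3 hs, hCA hs, hg' hs]
  have key : ∀ f : (Vertex b → ℝ) → ℝ, sumOver (A ∪ C) (fun s => weight β h (A ∪ C) s * f s) s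
      = sumOver A (fun s => weight β h A s * gibbsAvg β h C f s) s *
        (sumOver C (weight β h C) s / weight β h C s * g' s) := by
    intro f
    rw [sumOver_union H.1, hS, ← sumOver_mul_right hindep]
    congr 1; funext s; rw [hw']; ring
  have k1 := key (fun _ => 1)
  have hc : (gibbsAvg β h C fun _ => (1 : ℝ)) = fun _ => 1 := by
    funext s; exact gibbsAvg_const ..
  simp only [hc, mul_one] at k1
  rw [gibbsAvg, key, k1, gibbsAvg, mul_div_mul_right]
  exact (mul_pos (div_pos (sumOver_pos C (weight_pos β h C) s) (weight_pos ..)) (hg0' s)).ne'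

lemma gibbsAvg_comm {A C : Finset (Vertex b)} (H : Separated A C) (f : (Vertex b → ℝ) → ℝ) :
    gibbsAvg β h A (gibbsAvg β h C f) = gibbsAvg β h C (gibbsAvg β h A f) := by
  rw [← gibbsAvg_union β h H, ← gibbsAvg_union β h H.symm, Finset.union_comm]

lemma sq_gibbsAvg_le (A : Finset (Vertex b)) (f : (Vertex b → ℝ) → ℝ) (s : Vertex b → ℝ) :
    gibbsAvg β h A f s ^ 2 ≤ gibbsAvg β h A (fun s => f s ^ 2) s := by
  have h0 : 0 ≤ gibbsAvg β h A (fun t => (f t - gibbsAvg β h A f s) ^ 2) s :=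
    gibbsAvg_nonneg β h fun ξ => sq_nonneg _
  have e : (fun t => (f t - gibbsAvg β h A f s) ^ 2) = fun t =>
      (f t ^ 2 - (2 * gibbsAvg β h A f s) * f t) + gibbsAvg β h A f s ^ 2 := by
    funext t; ring
  rw [e, gibbsAvg_add, gibbsAvg_sub, gibbsAvg_smul, gibbsAvg_const] at h0
  nlinarith

end

section

open Finset

variable {b : ℕ} (β h : ℝ)

/-! ### The second-moment functional -/

/-- Second moment of `f` under the Gibbs distribution on `V` with boundary values `s₀`. -/
def sqNorm (V : Finset (Vertex b)) (s₀ : Vertex b → ℝ) (f : (Vertex b → ℝ) → ℝ) : ℝ :=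
  gibbsAvg β h V (fun s => f s ^ 2) s₀

variable (V : Finset (Vertex b)) (s₀ : Vertex b → ℝ)

lemma sqNorm_nonneg (f : (Vertex b → ℝ) → ℝ) : 0 ≤ sqNorm β h V s₀ f :=
  gibbsAvg_nonneg β h fun _ => sq_nonneg _

variable {V}

/-- The average over A is a self-adjoint idempotent in L² of the Gibbs distribution on V. -/
lemma gibbsAvg_mul_gibbsAvg {A : Finset (Vertex b)} (hA : A ⊆ V) (f g : (Vertex b → ℝ) → ℝ) :
    gibbsAvg β h V (fun s => gibbsAvg β h A f s * g s) s₀ =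
      gibbsAvg β h V (fun s => gibbsAvg β h A f s * gibbsAvg β h A g s) s₀ := by
  conv_lhs => rw [← gibbsAvg_gibbsAvg_of_subset β h hA]
  congr 1
  funext s
  exact gibbsAvg_mul_left β h (gibbsAvg_dependsOn β h A f) g s

lemma sqNorm_gibbsAvg_le {A : Finset (Vertex b)} (hA : A ⊆ V) (f : (Vertex b → ℝ) → ℝ) :
    sqNorm β h V s₀ (gibbsAvg β h A f) ≤ sqNorm β h V s₀ f := by
  unfold sqNorm
  rw [← gibbsAvg_gibbsAvg_of_subset β h hA (fun s => f s ^ 2)]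
  exact gibbsAvg_mono β h fun ξ => sq_gibbsAvg_le ..

/-- Pythagoras for nested orthogonal projections. -/
lemma sqNorm_gibbsAvg_sub {A C : Finset (Vertex b)} (hAC : A ⊆ C) (hC : C ⊆ V)
    (f : (Vertex b → ℝ) → ℝ) :
    sqNorm β h V s₀ (fun s => gibbsAvg β h A f s - gibbsAvg β h C f s) =
      sqNorm β h V s₀ (gibbsAvg β h A f) - sqNorm β h V s₀ (gibbsAvg β h C f) := by
  have e : (fun s => (gibbsAvg β h A f s - gibbsAvg β h C f s) ^ 2) = fun s =>
      gibbsAvg β h A f s ^ 2 - 2 * (gibbsAvg β h C f s * gibbsAvg β h A f s)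
        + gibbsAvg β h C f s ^ 2 := by funext s; ring
  have k := gibbsAvg_mul_gibbsAvg β h s₀ hC f (gibbsAvg β h A f)
  rw [gibbsAvg_gibbsAvg_of_subset β h hAC] at k
  unfold sqNorm
  rw [e, gibbsAvg_add, gibbsAvg_sub, gibbsAvg_smul, k]
  simp only [pow_two]
  ring

lemma sqNorm_sub_gibbsAvg {C : Finset (Vertex b)} (hC : C ⊆ V) (f : (Vertex b → ℝ) → ℝ) :
    sqNorm β h V s₀ (fun s => f s - gibbsAvg β h C f s) =
      sqNorm β h V s₀ f - sqNorm β h V s₀ (gibbsAvg β h C f) := by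
  have := sqNorm_gibbsAvg_sub β h s₀ (empty_subset C) hC f
  rwa [gibbsAvg_empty] at this

lemma sqNorm_add_le (f g : (Vertex b → ℝ) → ℝ) : sqNorm β h V s₀ (fun s => f s + g s) ≤
    2 * sqNorm β h V s₀ f + 2 * sqNorm β h V s₀ g := by
  unfold sqNorm
  rw [← gibbsAvg_smul, ← gibbsAvg_smul, ← gibbsAvg_add]
  exact gibbsAvg_mono β h fun ξ => by
    nlinarith [sq_nonneg (f (spinValues V s₀ ξ) - g (spinValues V s₀ ξ))]

lemma sq_gibbsAvg_mul_le (f g : (Vertex b → ℝ) → ℝ) :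
    gibbsAvg β h V (fun s => f s * g s) s₀ ^ 2 ≤ sqNorm β h V s₀ f * sqNorm β h V s₀ g := by
  unfold sqNorm
  simp only [gibbsAvg_eq_sum]
  have := Finset.sum_mul_sq_le_sq_mul_sq univ
    (fun ξ : V → Bool => √(gibbs β h V s₀ ξ) * f (spinValues V s₀ ξ))
    (fun ξ : V → Bool => √(gibbs β h V s₀ ξ) * g (spinValues V s₀ ξ))
  have e : ∀ ξ : V → Bool, √(gibbs β h V s₀ ξ) ^ 2 = gibbs β h V s₀ ξ :=
    fun ξ => Real.sq_sqrt (gibbs_pos ..).le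
  simp only [mul_pow, e] at this
  refine le_trans (le_of_eq ?_) this
  congr 1
  refine Finset.sum_congr rfl fun ξ _ => ?_
  linear_combination (-(f (spinValues V s₀ ξ) * g (spinValues V s₀ ξ))) * e ξ

/-! ### Descendants -/

/-- The vertices of `V` that are descendants of `x`, including `x` itself. -/
def desc (V : Finset (Vertex b)) (x : Vertex b) : Finset (Vertex b) := V.filter (x <:+ ·)

lemma mem_desc {x v : Vertex b} : v ∈ desc V x ↔ v ∈ V ∧ x <:+ v := by simp [desc]

lemma desc_subset (x : Vertex b) : desc V x ⊆ V := filter_subset _ _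

lemma self_mem_desc {x : Vertex b} (hx : x ∈ V) : x ∈ desc V x :=
  mem_desc.2 ⟨hx, List.suffix_refl x⟩

/-- `D` is a set of vertices of `V` that contains all descendants in `V` of its members. -/
def DescClosed (V D : Finset (Vertex b)) : Prop :=
  D ⊆ V ∧ ∀ v ∈ D, ∀ w ∈ V, v <:+ w → w ∈ D

lemma descClosed_empty : DescClosed V ∅ := ⟨empty_subset _, by simp⟩

lemma descClosed_self : DescClosed V V := ⟨Subset.rfl, fun _ _ _ hw _ => hw⟩

lemma descClosed_desc (x : Vertex b) : DescClosed V (desc V x) :=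
  ⟨desc_subset x, fun _ hv _ hw hvw => mem_desc.2 ⟨hw, (mem_desc.1 hv).2.trans hvw⟩⟩

lemma eq_of_suffix_of_suffix {x y : Vertex b} (h₁ : x <:+ y) (h₂ : y <:+ x) : x = y :=
  h₁.eq_of_length (le_antisymm h₁.length_le h₂.length_le)

lemma descClosed_desc_erase (x : Vertex b) : DescClosed V ((desc V x).erase x) := by
  refine ⟨(erase_subset _ _).trans (desc_subset x), fun v hv w hw hvw => ?_⟩
  rw [mem_erase, mem_desc] at hv ⊢
  refine ⟨?_, hw, hv.2.2.trans hvw⟩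
  rintro rfl
  exact hv.1 (eq_of_suffix_of_suffix hvw hv.2.2)

lemma DescClosed.insert {D : Finset (Vertex b)} (hD : DescClosed V D) {y : Vertex b} (hy : y ∈ V)
    (hyD : (desc V y).erase y ⊆ D) : DescClosed V (insert y D) := by
  refine ⟨insert_subset hy hD.1, fun v hv w hw hvw => ?_⟩
  rcases mem_insert.1 hv with rfl | hv
  · by_cases e : w = v
    · simp [e]
    · exact mem_insert_of_mem (hyD (mem_erase.2 ⟨e, mem_desc.2 ⟨hw, hvw⟩⟩))
  · exact mem_insert_of_mem (hD.2 v hv w hw hvw)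

/-- Induction that adds one vertex at a time, after all its descendants. -/
theorem DescClosed.induction {D C : Finset (Vertex b)} (hD : DescClosed V D)
    (hC : DescClosed V C) (hDC : D ⊆ C) (P : Finset (Vertex b) → Prop) (h0 : P D)
    (step : ∀ D' y, DescClosed V D' → D ⊆ D' → D' ⊆ C → y ∈ C → y ∉ D' →
      (desc V y).erase y ⊆ D' → P D' → P (Insert.insert y D')) : P C := by
  suffices H : ∀ n D', (C \ D').card = n → DescClosed V D' → D ⊆ D' → D' ⊆ C → P D' → P C from
    H _ D rfl hD Subset.rfl hDC h0
  intro n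
  induction n with
  | zero =>
    intro D' hn _ _ h2 h3
    rw [card_eq_zero, sdiff_eq_empty_iff_subset] at hn
    exact hn.antisymm h2 ▸ h3
  | succ n ih =>
    intro D' hn hD' h1 h2 h3
    have hne : (C \ D').Nonempty := card_pos.1 (by omega)
    -- A missing vertex of maximal depth: its proper descendants are deeper, hence already present.
    obtain ⟨y, hy, hmax⟩ := exists_max_image (C \ D') List.length hne
    have hyC := (mem_sdiff.1 hy).1
    have hyD := (mem_sdiff.1 hy).2
    have hsub : (desc V y).erase y ⊆ D' := by
      intro w hw
      rw [mem_erase, mem_desc] at hw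
      by_contra hwD
      have hl := hmax w (mem_sdiff.2 ⟨hC.2 y hyC w hw.2.1 hw.2.2, hwD⟩)
      exact hw.1 (hw.2.2.eq_of_length (le_antisymm hw.2.2.length_le hl)).symm
    refine ih (Insert.insert y D') ?_ (hD'.insert (hC.1 hyC) hsub) (h1.trans (subset_insert _ _))
      (insert_subset hyC h2) (step D' y hD' h1 h2 hyC hyD hsub h3)
    rw [sdiff_insert, card_erase_of_mem hy, hn]; rfl

lemma suffix_tail_of_ne {y v : Vertex b} (h1 : y <:+ v) (h2 : v ≠ y) : y <:+ v.tail := by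
  cases v with
  | nil => exact absurd (List.suffix_nil.1 h1).symm h2
  | cons a l =>
    rcases List.suffix_cons_iff.1 h1 with e | e
    · exact absurd e.symm h2
    · exact e

/-- The subtree at y is joined to the rest of the tree only through the parent of y, and that parent
is not in D, since otherwise y would be. -/
lemma separated_desc {D : Finset (Vertex b)} (hD : DescClosed V D) {y : Vertex b} (hy : y ∈ V)
    (hyD : y ∉ D) : Separated (D \ desc V y) (desc V y) := by
  refine ⟨sdiff_disjoint, fun v hv h0 hc => ?_, fun v hv h0 hc => ?_⟩
  · rw [mem_sdiff] at hv
    exact hv.2 (mem_desc.2 ⟨hD.1 hv.1, (mem_desc.1 hc).2.trans (List.tail_suffix v)⟩)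
  · rw [mem_sdiff] at hc
    by_cases e : v = y
    · subst e
      exact hyD (hD.2 _ hc.1 v hy (List.tail_suffix v))
    · exact hc.2 (mem_desc.2 ⟨hD.1 hc.1, suffix_tail_of_ne (mem_desc.1 hv).2 e⟩)

lemma sdiff_desc_union_erase {D : Finset (Vertex b)} {y : Vertex b}
    (hyD : y ∉ D) (hsub : (desc V y).erase y ⊆ D) :
    (D \ desc V y) ∪ (desc V y).erase y = D := by
  ext v
  simp only [mem_union, mem_sdiff, mem_erase]
  constructor
  · rintro (h | h)
    · exact h.1
    · exact hsub (mem_erase.2 h)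
  · intro hv
    by_cases hd : v ∈ desc V y
    · exact Or.inr ⟨fun e => hyD (e ▸ hv), hd⟩
    · exact Or.inl ⟨hv, hd⟩

lemma sdiff_desc_union {D : Finset (Vertex b)} {y : Vertex b} (hy : y ∈ V)
    (hsub : (desc V y).erase y ⊆ D) :
    (D \ desc V y) ∪ desc V y = insert y D := by
  ext v
  simp only [mem_union, mem_sdiff, mem_insert]
  constructor
  · rintro (h | h)
    · exact Or.inr h.1
    · by_cases e : v = y
      · exact Or.inl e
      · exact Or.inr (hsub (mem_erase.2 ⟨e, h⟩))
  · rintro (rfl | hv)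
    · exact Or.inr (self_mem_desc hy)
    · exact (em _).symm.imp (fun h => ⟨hv, h⟩) id

/-- Together with `gibbsAvg_insert_eq`: adding y to D changes only the inner average over the
subtree at y, while the outer average stays the same. -/
lemma gibbsAvg_eq_erase {D : Finset (Vertex b)} (hD : DescClosed V D) {y : Vertex b} (hy : y ∈ V)
    (hyD : y ∉ D) (hsub : (desc V y).erase y ⊆ D) (f : (Vertex b → ℝ) → ℝ) :
    gibbsAvg β h D f = gibbsAvg β h (D \ desc V y) (gibbsAvg β h ((desc V y).erase y) f) := by
  rw [← gibbsAvg_union β h ((separated_desc hD hy hyD).mono Subset.rfl (erase_subset _ _)),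
    sdiff_desc_union_erase hyD hsub]

lemma gibbsAvg_insert_eq {D : Finset (Vertex b)} (hD : DescClosed V D) {y : Vertex b} (hy : y ∈ V)
    (hyD : y ∉ D) (hsub : (desc V y).erase y ⊆ D) (f : (Vertex b → ℝ) → ℝ) :
    gibbsAvg β h (insert y D) f = gibbsAvg β h (D \ desc V y) (gibbsAvg β h (desc V y) f) := by
  rw [← gibbsAvg_union β h (separated_desc hD hy hyD), sdiff_desc_union hy hsub]

/-! ### Decomposition of the variance along the tree -/

/-- The contribution of `y` to the variance of `f`: the mean of the variance, in the Gibbs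
distribution on the descendants of `y`, of the conditional expectation of `f` given the spin
at `y`. -/
def siteVar (V : Finset (Vertex b)) (s₀ : Vertex b → ℝ) (f : (Vertex b → ℝ) → ℝ) (y : Vertex b) :
    ℝ :=
  sqNorm β h V s₀ fun s => gibbsAvg β h ((desc V y).erase y) f s - gibbsAvg β h (desc V y) f s

lemma siteVar_nonneg (f : (Vertex b → ℝ) → ℝ) (y : Vertex b) : 0 ≤ siteVar β h V s₀ f y :=
  sqNorm_nonneg ..

/-- Telescoping over the added vertices. The increment at y is, by Pythagoras, the second moment of
an average of the function that defines `siteVar`, and averaging contracts second moments. -/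
theorem sqNorm_sub_le_sum_siteVar {D C : Finset (Vertex b)} (hD : DescClosed V D)
    (hC : DescClosed V C) (hDC : D ⊆ C) (f : (Vertex b → ℝ) → ℝ) :
    sqNorm β h V s₀ (gibbsAvg β h D f) - sqNorm β h V s₀ (gibbsAvg β h C f) ≤
      ∑ y ∈ C \ D, siteVar β h V s₀ f y := by
  refine hD.induction hC hDC (fun D' => sqNorm β h V s₀ (gibbsAvg β h D f) -
    sqNorm β h V s₀ (gibbsAvg β h D' f) ≤ ∑ y ∈ D' \ D, siteVar β h V s₀ f y) (by simp) ?_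
  intro D' y hD' hDD' hD'C hyC hyD hsub ih
  have hyV := hC.1 hyC
  have key : sqNorm β h V s₀ (gibbsAvg β h D' f) -
      sqNorm β h V s₀ (gibbsAvg β h (insert y D') f) ≤ siteVar β h V s₀ f y := by
    rw [← sqNorm_gibbsAvg_sub β h s₀ (subset_insert y D') (insert_subset hyV hD'.1),
      gibbsAvg_eq_erase β h hD' hyV hyD hsub, gibbsAvg_insert_eq β h hD' hyV hyD hsub]
    have := sqNorm_gibbsAvg_le β h s₀ (V := V) (A := D' \ desc V y)
      (sdiff_subset.trans hD'.1)
      (fun s => gibbsAvg β h ((desc V y).erase y) f s - gibbsAvg β h (desc V y) f s)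
    refine le_trans (le_of_eq ?_) this
    congr 1
    funext s
    rw [gibbsAvg_sub]
  have hyD0 : y ∉ D := fun hc => hyD (hDD' hc)
  rw [insert_sdiff_of_notMem _ hyD0, sum_insert (by simp [hyD])]
  linarith

end

section

open Finset

variable {b : ℕ} (β h : ℝ)

/-! ### A crude Poincaré inequality for small blocks -/

lemma abs_spin (t : Bool) : |spin t| = 1 := by cases t <;> simp [spin]

lemma abs_spinValues_le {A : Finset (Vertex b)} {s : Vertex b → ℝ} (hs : ∀ v, |s v| ≤ 1)
    (ξ : A → Bool) (v : Vertex b) : |spinValues A s ξ v| ≤ 1 := by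
  by_cases hv : v ∈ A
  · rw [spinValues_of_mem hv, abs_spin]
  · rw [spinValues_of_notMem hv]; exact hs v

lemma abs_update_le {s : Vertex b → ℝ} (hs : ∀ v, |s v| ≤ 1) (y : Vertex b) {a : ℝ}
    (ha : |a| ≤ 1) (v : Vertex b) : |Function.update s y a v| ≤ 1 := by
  by_cases e : v = y
  · subst e; simpa using ha
  · simpa [Function.update_of_ne e] using hs v

lemma spinValues_update_of_notMem {A : Finset (Vertex b)} {y : Vertex b} (hy : y ∉ A)
    (s : Vertex b → ℝ) (a : ℝ) (ξ : A → Bool) :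
    spinValues A (Function.update s y a) ξ = Function.update (spinValues A s ξ) y a := by
  funext v
  by_cases e : v = y
  · subst e; simp [spinValues_of_notMem hy]
  · rw [Function.update_of_ne e]
    by_cases hv : v ∈ A
    · rw [spinValues_of_mem hv, spinValues_of_mem hv]
    · rw [spinValues_of_notMem hv, spinValues_of_notMem hv, Function.update_of_ne e]

lemma card_edgesMeeting_le (A : Finset (Vertex b)) : (edgesMeeting A).card ≤ (b + 1) * A.card := by
  unfold edgesMeeting
  refine (card_le_card (erase_subset _ _)).trans ((card_union_le _ _).trans ?_)
  have : (A.biUnion fun v => univ.image fun i : Fin b => i :: v).card ≤ A.card * b :=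
    card_biUnion_le_card_mul _ _ _ fun v _ => card_image_le.trans (by simp)
  nlinarith

/-- A bound for the energy of `K` spins. -/
def energyBound (b : ℕ) (β h : ℝ) (K : ℕ) : ℝ := |β| * ((b + 1) * K + |h| * K)

lemma abs_log_weight_le {A : Finset (Vertex b)} {K : ℕ} (hA : A.card ≤ K) {s : Vertex b → ℝ}
    (hs : ∀ v, |s v| ≤ 1) :
    |β * (∑ w ∈ edgesMeeting A, s w * s w.tail + h * ∑ x ∈ A, s x)| ≤ energyBound b β h K := by
  have hK : (A.card : ℝ) ≤ K := by exact_mod_cast hA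
  rw [abs_mul, energyBound]
  refine mul_le_mul_of_nonneg_left ((abs_add_le _ _).trans (add_le_add ?_ ?_)) (abs_nonneg β)
  · calc |∑ w ∈ edgesMeeting A, s w * s w.tail| ≤ ∑ w ∈ edgesMeeting A, (1 : ℝ) :=
          (abs_sum_le_sum_abs _ _).trans (sum_le_sum fun w _ => by
            rw [abs_mul]; exact mul_le_one₀ (hs w) (abs_nonneg _) (hs _))
      _ = (edgesMeeting A).card := by simp
      _ ≤ ((b + 1) * A.card : ℕ) := by exact_mod_cast card_edgesMeeting_le A
      _ ≤ (b + 1) * K := by push_cast; gcongr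
  · rw [abs_mul]
    refine mul_le_mul_of_nonneg_left ?_ (abs_nonneg h)
    calc |∑ x ∈ A, s x| ≤ ∑ x ∈ A, (1 : ℝ) :=
          (abs_sum_le_sum_abs _ _).trans (sum_le_sum fun w _ => hs w)
      _ = A.card := by simp
      _ ≤ K := hK

lemma weight_le_exp {A : Finset (Vertex b)} {K : ℕ} (hA : A.card ≤ K) {s : Vertex b → ℝ}
    (hs : ∀ v, |s v| ≤ 1) : weight β h A s ≤ Real.exp (energyBound b β h K) :=
  Real.exp_le_exp.2 (abs_le.1 (abs_log_weight_le β h hA hs)).2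

lemma exp_neg_le_weight {A : Finset (Vertex b)} {K : ℕ} (hA : A.card ≤ K) {s : Vertex b → ℝ}
    (hs : ∀ v, |s v| ≤ 1) : Real.exp (-energyBound b β h K) ≤ weight β h A s :=
  Real.exp_le_exp.2 (abs_le.1 (abs_log_weight_le β h hA hs)).1

/-- Difference of `f` between spin `+1` and spin `-1` at `y`. -/
def spinDiff (y : Vertex b) (f : (Vertex b → ℝ) → ℝ) (s : Vertex b → ℝ) : ℝ :=
  f (Function.update s y 1) - f (Function.update s y (-1))

lemma sumOver_insert {A : Finset (Vertex b)} {y : Vertex b} (hy : y ∉ A)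
    (f : (Vertex b → ℝ) → ℝ) (s : Vertex b → ℝ) : sumOver (insert y A) f s =
      sumOver A f (Function.update s y 1) + sumOver A f (Function.update s y (-1)) := by
  rw [insert_eq, sumOver_union (by simpa using hy), sumOver_singleton]

lemma sumOver_nonneg (A : Finset (Vertex b)) {f : (Vertex b → ℝ) → ℝ} (hf : ∀ s, 0 ≤ f s)
    (s : Vertex b → ℝ) : 0 ≤ sumOver A f s :=
  Finset.sum_nonneg fun _ _ => hf _

/-- Each configuration is compared with the all-plus one by flipping one spin after another. A new
vertex replaces the sum S by at most 3 S plus twice a flip term, which the factor 4 per vertex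
covers. -/
theorem sumOver_sq_sub_le (A : Finset (Vertex b)) (f : (Vertex b → ℝ) → ℝ) (s : Vertex b → ℝ) :
    sumOver A (fun t => (f t - f (spinValues A s fun _ => true)) ^ 2) s ≤
      4 ^ A.card * ∑ y ∈ A, sumOver A (fun t => spinDiff y f t ^ 2) s := by
  induction A using Finset.induction_on generalizing s with
  | empty =>
    have e : spinValues (∅ : Finset (Vertex b)) s (fun _ => true) = s := by
      funext v; simp [spinValues]
    simp [sumOver_empty, e]
  | insert y A hy ih =>
    have e : spinValues (insert y A) s (fun _ => true)
        = spinValues A (Function.update s y 1) (fun _ => true) := by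
      funext v
      by_cases hv : v ∈ A
      · rw [spinValues_of_mem hv, spinValues_of_mem (mem_insert_of_mem hv)]
      · rw [spinValues_of_notMem hv]
        by_cases e : v = y
        · subst e; rw [spinValues_of_mem (mem_insert_self _ _)]; simp [spin]
        · rw [Function.update_of_ne e, spinValues_of_notMem (by simp [e, hv])]
    set c := f (spinValues (insert y A) s fun _ => true) with hc
    have ih1 := ih (Function.update s y 1)
    rw [← e] at ih1
    have h2 : sumOver A (fun t => (f t - c) ^ 2) (Function.update s y (-1)) ≤
        2 * sumOver A (fun t => spinDiff y f t ^ 2) (Function.update s y (-1)) +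
        2 * sumOver A (fun t => (f t - c) ^ 2) (Function.update s y 1) := by
      unfold sumOver
      rw [mul_sum, mul_sum, ← sum_add_distrib]
      refine sum_le_sum fun ξ _ => ?_
      rw [spinValues_update_of_notMem hy, spinValues_update_of_notMem hy]
      simp only [spinDiff, Function.update_idem]
      nlinarith [sq_nonneg (f (Function.update (spinValues A s ξ) y 1) -
        f (Function.update (spinValues A s ξ) y (-1)) +
        (f (Function.update (spinValues A s ξ) y 1) - c))]
    have nn : ∀ z t, 0 ≤ sumOver A (fun t => spinDiff z f t ^ 2) t :=
      fun z t => sumOver_nonneg A (fun _ => sq_nonneg _) t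
    have n1 := nn y (Function.update s y 1)
    have n2 := nn y (Function.update s y (-1))
    have n3 : 0 ≤ ∑ z ∈ A, sumOver A (fun t => spinDiff z f t ^ 2) (Function.update s y (-1)) :=
      sum_nonneg fun z _ => nn z _
    have n4 : 0 ≤ ∑ z ∈ A, sumOver A (fun t => spinDiff z f t ^ 2) (Function.update s y 1) :=
      sum_nonneg fun z _ => nn z _
    rw [sumOver_insert hy, sum_insert hy, card_insert_of_notMem hy, pow_succ]
    simp only [sumOver_insert hy, sum_add_distrib]
    have h4 : (1 : ℝ) ≤ 4 ^ A.card := one_le_pow₀ (by norm_num)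
    nlinarith [mul_nonneg (by linarith : (0 : ℝ) ≤ 4 ^ A.card) n1,
      mul_nonneg (by linarith : (0 : ℝ) ≤ 4 ^ A.card - 1) n2,
      mul_nonneg (by linarith : (0 : ℝ) ≤ 4 ^ A.card) n3,
      mul_nonneg (by linarith : (0 : ℝ) ≤ 4 ^ A.card) n4]

/-- On the configurations charged by the outer average, the inner one is a constant. -/
lemma gibbsAvg_sq_sub_self (A : Finset (Vertex b)) (f : (Vertex b → ℝ) → ℝ) (s : Vertex b → ℝ) :
    gibbsAvg β h A (fun t => (f t - gibbsAvg β h A f t) ^ 2) s =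
      gibbsAvg β h A (fun t => (f t - gibbsAvg β h A f s) ^ 2) s := by
  rw [gibbsAvg_eq_sum, gibbsAvg_eq_sum]
  simp only [dependsOn_spinValues (gibbsAvg_dependsOn β h A f)]

lemma gibbsAvg_sq_sub_le (A : Finset (Vertex b)) (f : (Vertex b → ℝ) → ℝ) (s : Vertex b → ℝ)
    (c : ℝ) : gibbsAvg β h A (fun t => (f t - gibbsAvg β h A f t) ^ 2) s ≤
      gibbsAvg β h A (fun t => (f t - c) ^ 2) s := by
  rw [gibbsAvg_sq_sub_self]
  have e : ∀ a, (fun t => (f t - a) ^ 2) = fun t => (f t ^ 2 - (2 * a) * f t) + a ^ 2 := by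
    intro a; funext t; ring
  rw [e, e, gibbsAvg_add, gibbsAvg_sub, gibbsAvg_smul, gibbsAvg_const, gibbsAvg_add, gibbsAvg_sub,
    gibbsAvg_smul, gibbsAvg_const]
  nlinarith [sq_nonneg (gibbsAvg β h A f s - c)]

/-- For bounded outside spins both single-site weights lie between exp(-Q) and exp Q, so the
single-site variance controls the squared jump. -/
lemma sq_spinDiff_le (y : Vertex b) (f : (Vertex b → ℝ) → ℝ) {s : Vertex b → ℝ}
    (hs : ∀ v, |s v| ≤ 1) : spinDiff y f s ^ 2 ≤ 4 * Real.exp (2 * energyBound b β h 1) *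
      gibbsAvg β h {y} (fun t => (f t - gibbsAvg β h {y} f t) ^ 2) s := by
  rw [gibbsAvg_sq_sub_self]
  set c := gibbsAvg β h {y} f s
  set Q := energyBound b β h 1
  have h1 : ({y} : Finset (Vertex b)).card ≤ 1 := by simp
  have hp := abs_update_le hs y (a := 1) (by simp)
  have hm := abs_update_le hs y (a := -1) (by simp)
  have u1 := weight_le_exp β h h1 hp
  have u2 := weight_le_exp β h h1 hm
  have l1 := exp_neg_le_weight β h h1 hp
  have l2 := exp_neg_le_weight β h h1 hm
  rw [gibbsAvg, sumOver_singleton, sumOver_singleton, mul_div_assoc', le_div_iff₀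
    (add_pos (weight_pos ..) (weight_pos ..))]
  rw [spinDiff]
  set x := f (Function.update s y 1)
  set z := f (Function.update s y (-1))
  have hQ : Real.exp (2 * Q) * Real.exp (-Q) = Real.exp Q := by rw [← Real.exp_add]; ring_nf
  calc (x - z) ^ 2 * (weight β h {y} (Function.update s y 1)
        + weight β h {y} (Function.update s y (-1)))
      ≤ (2 * (x - c) ^ 2 + 2 * (z - c) ^ 2) * (Real.exp Q + Real.exp Q) := by
        refine mul_le_mul ?_ (add_le_add u1 u2) (add_pos (weight_pos ..) (weight_pos ..)).le
          (by positivity)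
        nlinarith [sq_nonneg (x - c + (z - c))]
    _ = 4 * Real.exp (2 * Q) * (Real.exp (-Q) * (x - c) ^ 2 + Real.exp (-Q) * (z - c) ^ 2) := by
        rw [← hQ]; ring
    _ ≤ _ := by gcongr

/-- Constant in the block Poincaré inequality. -/
def blockConst (b : ℕ) (β h : ℝ) (K : ℕ) : ℝ :=
  Real.exp (2 * energyBound b β h K) * 4 ^ K * (4 * Real.exp (2 * energyBound b β h 1))

lemma blockConst_pos (K : ℕ) : 0 < blockConst b β h K := by unfold blockConst; positivity

/-- The Gibbs weights on a block of bounded size are comparable to counting measure, where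
`sumOver_sq_sub_le` applies; the comparison is made once in each direction, and the same is done at
single sites. -/
theorem gibbsAvg_sq_sub_le_sum {A : Finset (Vertex b)} {K : ℕ} (hA : A.card ≤ K)
    (f : (Vertex b → ℝ) → ℝ) {s : Vertex b → ℝ} (hs : ∀ v, |s v| ≤ 1) :
    gibbsAvg β h A (fun t => (f t - gibbsAvg β h A f t) ^ 2) s ≤
      blockConst b β h K * ∑ y ∈ A, gibbsAvg β h A (gibbsAvg β h {y}
        (fun t => (f t - gibbsAvg β h {y} f t) ^ 2)) s := by
  set Q := energyBound b β h K with hQdef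
  refine (gibbsAvg_sq_sub_le β h A f s (f (spinValues A s fun _ => true))).trans ?_
  have hQ : Real.exp (2 * Q) * Real.exp (-Q) = Real.exp Q := by rw [← Real.exp_add]; ring_nf
  have hW := sumOver_pos A (weight_pos β h A) s
  have step1 : gibbsAvg β h A (fun t => (f t - f (spinValues A s fun _ => true)) ^ 2) s ≤
      Real.exp (2 * Q) * 4 ^ K * ∑ y ∈ A, gibbsAvg β h A (fun t => spinDiff y f t ^ 2) s := by
    simp only [gibbsAvg]
    rw [← sum_div, mul_div_assoc']
    refine div_le_div_of_nonneg_right ?_ hW.le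
    have a1 : sumOver A (fun t => weight β h A t *
        (f t - f (spinValues A s fun _ => true)) ^ 2) s ≤ Real.exp Q *
        sumOver A (fun t => (f t - f (spinValues A s fun _ => true)) ^ 2) s := by
      unfold sumOver
      rw [mul_sum]
      exact sum_le_sum fun ξ _ => mul_le_mul_of_nonneg_right
        (weight_le_exp β h hA (abs_spinValues_le hs ξ)) (sq_nonneg _)
    have a2 : ∀ y, Real.exp (-Q) * sumOver A (fun t => spinDiff y f t ^ 2) s ≤
        sumOver A (fun t => weight β h A t * spinDiff y f t ^ 2) s := fun y => by
      unfold sumOver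
      rw [mul_sum]
      exact sum_le_sum fun ξ _ => mul_le_mul_of_nonneg_right
        (exp_neg_le_weight β h hA (abs_spinValues_le hs ξ)) (sq_nonneg _)
    have nn : 0 ≤ ∑ y ∈ A, sumOver A (fun t => spinDiff y f t ^ 2) s :=
      sum_nonneg fun y _ => sumOver_nonneg A (fun _ => sq_nonneg _) s
    calc _ ≤ _ := a1
      _ ≤ Real.exp Q * (4 ^ A.card * ∑ y ∈ A, sumOver A (fun t => spinDiff y f t ^ 2) s) := by
        gcongr; exact sumOver_sq_sub_le A f s
      _ ≤ Real.exp Q * (4 ^ K * ∑ y ∈ A, sumOver A (fun t => spinDiff y f t ^ 2) s) := by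
        gcongr; norm_num
      _ = Real.exp (2 * Q) * 4 ^ K *
          ∑ y ∈ A, Real.exp (-Q) * sumOver A (fun t => spinDiff y f t ^ 2) s := by
        rw [← mul_sum, ← hQ]; ring
      _ ≤ _ := by gcongr; exact a2 _
  refine step1.trans ?_
  rw [blockConst, mul_assoc (Real.exp _ * _), mul_sum (a := 4 * Real.exp _)]
  refine mul_le_mul_of_nonneg_left (sum_le_sum fun y _ => ?_) (by positivity)
  rw [← gibbsAvg_smul]
  exact gibbsAvg_mono β h fun ξ => sq_spinDiff_le β h y f (abs_spinValues_le hs ξ)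

theorem block_poincare {V A : Finset (Vertex b)} (hAV : A ⊆ V) {K : ℕ} (hA : A.card ≤ K)
    (f : (Vertex b → ℝ) → ℝ) {s₀ : Vertex b → ℝ} (hs : ∀ v, |s₀ v| ≤ 1) :
    sqNorm β h V s₀ (fun s => f s - gibbsAvg β h A f s) ≤ blockConst b β h K *
      ∑ y ∈ A, sqNorm β h V s₀ (fun s => f s - gibbsAvg β h {y} f s) := by
  have e : ∀ y ∈ A, gibbsAvg β h V (gibbsAvg β h A (gibbsAvg β h {y}
        (fun t => (f t - gibbsAvg β h {y} f t) ^ 2))) s₀ =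
      sqNorm β h V s₀ (fun s => f s - gibbsAvg β h {y} f s) := fun y hy => by
    rw [gibbsAvg_gibbsAvg_of_subset β h hAV, gibbsAvg_gibbsAvg_of_subset β h
      (singleton_subset_iff.2 (hAV hy)), sqNorm]
  rw [← sum_congr rfl e, ← gibbsAvg_sum, ← gibbsAvg_smul, sqNorm,
    ← gibbsAvg_gibbsAvg_of_subset β h hAV]
  exact gibbsAvg_mono β h fun ξ => gibbsAvg_sq_sub_le_sum β h hA f (abs_spinValues_le hs ξ)

end

section

open Finset

variable {b : ℕ} (β h : ℝ)

/-! ### Subtrees and the recursion for effective fields -/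

/-- The descendants of `x` at distance less than `k` from `x`. -/
def subtree (x : Vertex b) : ℕ → Finset (Vertex b)
  | 0 => ∅
  | k + 1 => insert x (univ.biUnion fun i : Fin b => subtree (i :: x) k)

lemma mem_subtree {x v : Vertex b} {k : ℕ} :
    v ∈ subtree x k ↔ x <:+ v ∧ v.length < x.length + k := by
  induction k generalizing x with
  | zero =>
    simp only [subtree, notMem_empty, add_zero, false_iff, not_and, not_lt]
    exact fun hv => hv.length_le
  | succ k ih =>
    simp only [subtree, mem_insert, mem_biUnion, mem_univ, true_and, ih, List.length_cons]
    constructor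
    · rintro (rfl | ⟨i, hi, hl⟩)
      · exact ⟨List.suffix_refl v, by omega⟩
      · exact ⟨(List.suffix_cons i x).trans hi, by omega⟩
    · rintro ⟨⟨t, rfl⟩, hl⟩
      rcases List.eq_nil_or_concat t with rfl | ⟨L, i, rfl⟩
      · exact Or.inl rfl
      · refine Or.inr ⟨i, ⟨L, by simp⟩, by omega⟩

lemma cons_suffix_injective {x v : Vertex b} {i j : Fin b} (hi : i :: x <:+ v)
    (hj : j :: x <:+ v) : i = j := by
  have := (List.suffix_of_suffix_length_le hi hj (by simp)).eq_of_length (by simp)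
  exact (List.cons.inj this).1

lemma disjoint_subtree_cons (x : Vertex b) (k : ℕ) {i j : Fin b} (hij : i ≠ j) :
    Disjoint (subtree (i :: x) k) (subtree (j :: x) k) :=
  Finset.disjoint_left.2 fun _ h₁ h₂ =>
    hij (cons_suffix_injective (mem_subtree.1 h₁).1 (mem_subtree.1 h₂).1)

lemma notMem_biUnion_subtree (x : Vertex b) (k : ℕ) :
    x ∉ univ.biUnion fun i : Fin b => subtree (i :: x) k := by
  simp only [mem_biUnion, mem_univ, true_and, not_exists, mem_subtree]
  rintro i ⟨h1, -⟩
  have := h1.length_le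
  simp at this

lemma sum_subtree_succ (x : Vertex b) (k : ℕ) (g : Vertex b → ℝ) :
    ∑ v ∈ subtree x (k + 1), g v = g x + ∑ i : Fin b, ∑ v ∈ subtree (i :: x) k, g v := by
  rw [subtree, sum_insert (notMem_biUnion_subtree x k), sum_biUnion]
  exact fun i _ j _ hij => disjoint_subtree_cons x k hij

lemma completeTree_eq_subtree (b m : ℕ) : completeTree b m = subtree [] (m + 1) := by
  ext v
  simp [completeTree, mem_subtree]

/-- The spin of the parent of `x`, and `0` if `x` is the root. -/
def parentSpin (x : Vertex b) (s : Vertex b → ℝ) : ℝ := if x = [] then 0 else s x.tail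

lemma parentSpin_cons (i : Fin b) (x : Vertex b) (s : Vertex b → ℝ) :
    parentSpin (i :: x) s = s x := by simp [parentSpin]

/-- The logarithm of the weight of `subtree x k`, including the edge above `x`. -/
def localEnergy (x : Vertex b) (k : ℕ) (s : Vertex b → ℝ) : ℝ :=
  -- The edge sum goes one level deeper than the field sum: each vertex stands for the edge to its
  -- parent, so the last level supplies the edges to the boundary.
  β * (∑ v ∈ subtree x (k + 1), s v * parentSpin v s + h * ∑ v ∈ subtree x k, s v)

lemma localEnergy_zero (x : Vertex b) (s : Vertex b → ℝ) :
    localEnergy β h x 0 s = β * (s x * parentSpin x s) := by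
  rw [localEnergy, sum_subtree_succ]
  simp [subtree]

lemma localEnergy_succ (x : Vertex b) (k : ℕ) (s : Vertex b → ℝ) :
    localEnergy β h x (k + 1) s = s x * (β * h + β * parentSpin x s)
      + ∑ i : Fin b, localEnergy β h (i :: x) k s := by
  unfold localEnergy
  rw [sum_subtree_succ x (k + 1), sum_subtree_succ x k, ← mul_sum, sum_add_distrib, ← mul_sum]
  ring

/-- The case k = 0 is excluded because the empty set meets no edge, whereas `localEnergy` keeps the
edge above x. -/
lemma weight_subtree (x : Vertex b) {k : ℕ} (hk : k ≠ 0) (s : Vertex b → ℝ) :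
    weight β h (subtree x k) s = Real.exp (localEnergy β h x k s) := by
  have e : edgesMeeting (subtree x k) = (subtree x (k + 1)).erase [] := by
    ext w
    rw [mem_edgesMeeting, mem_erase]
    refine and_congr_right fun hw => ?_
    simp only [mem_subtree, List.length_tail]
    constructor
    · rintro (h1 | h1)
      · exact ⟨h1.1, by omega⟩
      · exact ⟨h1.1.trans (List.tail_suffix w), by omega⟩
    · rintro ⟨h1, h2⟩
      by_cases e : w = x
      · exact Or.inl ⟨h1, by subst e; omega⟩
      · have : 0 < w.length := List.length_pos_iff.2 hw
        exact Or.inr ⟨suffix_tail_of_ne h1 e, by omega⟩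
  unfold weight localEnergy
  congr 3
  rw [e, ← sum_erase (a := []) (subtree x (k + 1)) (by simp [parentSpin])]
  refine sum_congr rfl fun v hv => ?_
  rw [parentSpin, if_neg (ne_of_mem_erase hv)]

/-- The effective field exerted on its parent by a spin with field `a`. -/
def edgeMessage (a : ℝ) : ℝ := 1 / 2 * Real.log (Real.cosh (a + β) / Real.cosh (a - β))

lemma exp_edgeMessage (a : ℝ) : Real.exp (edgeMessage β a) =
    √(Real.cosh (a + β) / Real.cosh (a - β)) := by
  have h1 := Real.cosh_pos (a + β)
  have h2 := Real.cosh_pos (a - β)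
  rw [edgeMessage, mul_comm, Real.exp_mul, Real.exp_log (by positivity), Real.sqrt_eq_rpow]

/-- Every positive function of e = ±1 has the form c * exp (u * e); summing out a spin with field a
joined to the spin e gives u = `edgeMessage β a`. -/
lemma two_cosh_eq (a : ℝ) {e : ℝ} (he : e = 1 ∨ e = -1) :
    Real.exp (a + β * e) + Real.exp (-(a + β * e)) =
      2 * √(Real.cosh (a + β) * Real.cosh (a - β)) * Real.exp (edgeMessage β a * e) := by
  have h1 := Real.cosh_pos (a + β)
  have h2 := Real.cosh_pos (a - β)
  have e0 : Real.exp (a + β * e) + Real.exp (-(a + β * e)) = 2 * Real.cosh (a + β * e) := by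
    rw [Real.cosh_eq]; ring
  rw [e0, mul_assoc]
  congr 1
  rcases he with rfl | rfl
  · rw [mul_one, mul_one, exp_edgeMessage, ← Real.sqrt_mul (by positivity)]
    rw [show Real.cosh (a + β) * Real.cosh (a - β) * (Real.cosh (a + β) / Real.cosh (a - β))
      = Real.cosh (a + β) ^ 2 by field_simp, Real.sqrt_sq h1.le]
  · rw [mul_neg_one, mul_neg_one, Real.exp_neg, exp_edgeMessage, ← Real.sqrt_inv,
      ← Real.sqrt_mul (by positivity)]
    rw [show Real.cosh (a + β) * Real.cosh (a - β) * (Real.cosh (a + β) / Real.cosh (a - β))⁻¹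
      = Real.cosh (a - β) ^ 2 by field_simp, Real.sqrt_sq h2.le, ← sub_eq_add_neg]

/-- The effective field exerted by `subtree x k` on the parent of `x`, given the spins of `s`
at the descendants of `x` at distance `k`. -/
def message : ℕ → Vertex b → (Vertex b → ℝ) → ℝ
  | 0, x, s => β * s x
  | k + 1, x, s => edgeMessage β (β * h + ∑ i : Fin b, message k (i :: x) s)

/-- The field at `x` due to the part of the tree below `x`, given the spins of `s` at the
descendants of `x` at distance `k + 1`. -/
def effectiveField (k : ℕ) (x : Vertex b) (s : Vertex b → ℝ) : ℝ :=
  β * h + ∑ i : Fin b, message β h k (i :: x) s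

lemma message_succ (k : ℕ) (x : Vertex b) (s : Vertex b → ℝ) :
    message β h (k + 1) x s = edgeMessage β (effectiveField β h k x s) := rfl

/-- Prefactor in the partition function of `subtree x k`. -/
def partitionFactor : ℕ → Vertex b → (Vertex b → ℝ) → ℝ
  | 0, _, _ => 1
  | k + 1, x, s => (∏ i : Fin b, partitionFactor k (i :: x) s) *
      (2 * √(Real.cosh (effectiveField β h k x s + β) * Real.cosh (effectiveField β h k x s - β)))

lemma message_congr (k : ℕ) (x : Vertex b) {s s' : Vertex b → ℝ}
    (hs : ∀ v, x <:+ v → v.length = x.length + k → s v = s' v) :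
    message β h k x s = message β h k x s' := by
  induction k generalizing x with
  | zero => rw [message, message, hs x (List.suffix_refl x) rfl]
  | succ k ih =>
    rw [message, message]
    congr 2
    refine sum_congr rfl fun i _ => ih _ fun v hv hl => hs v ((List.suffix_cons i x).trans hv) ?_
    rw [hl, List.length_cons]; omega

lemma effectiveField_congr (k : ℕ) (x : Vertex b) {s s' : Vertex b → ℝ}
    (hs : ∀ v, x <:+ v → v.length = x.length + (k + 1) → s v = s' v) :
    effectiveField β h k x s = effectiveField β h k x s' := by
  unfold effectiveField
  congr 1
  refine sum_congr rfl fun i _ => message_congr β h k _ fun v hv hl =>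
    hs v ((List.suffix_cons i x).trans hv) ?_
  rw [hl, List.length_cons]; omega

lemma partitionFactor_congr (k : ℕ) (x : Vertex b) {s s' : Vertex b → ℝ}
    (hs : ∀ v, x <:+ v → v.length = x.length + k → s v = s' v) :
    partitionFactor β h k x s = partitionFactor β h k x s' := by
  induction k generalizing x with
  | zero => rfl
  | succ k ih =>
    rw [partitionFactor, partitionFactor, effectiveField_congr β h k x hs]
    congr 1
    refine prod_congr rfl fun i _ => ih _ fun v hv hl => hs v ((List.suffix_cons i x).trans hv) ?_
    rw [hl, List.length_cons]; omega

lemma partitionFactor_pos (k : ℕ) (x : Vertex b) (s : Vertex b → ℝ) :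
    0 < partitionFactor β h k x s := by
  induction k generalizing x with
  | zero => exact one_pos
  | succ k ih =>
    rw [partitionFactor]
    have h1 := Real.cosh_pos (effectiveField β h k x s + β)
    have h2 := Real.cosh_pos (effectiveField β h k x s - β)
    exact mul_pos (prod_pos fun i _ => ih _) (by positivity)

/-- Distributivity: each factor involves the spins of only one of the disjoint sets. -/
lemma sumOver_biUnion_prod {κ : Type*} [DecidableEq κ] (I : Finset κ) (A : κ → Finset (Vertex b))
    (hA : ∀ i j, i ≠ j → Disjoint (A i) (A j)) (w : κ → (Vertex b → ℝ) → ℝ)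
    (B : κ → Set (Vertex b)) (hw : ∀ i, DependsOn (w i) (B i))
    (hB : ∀ i j, i ≠ j → ∀ v ∈ B i, v ∉ A j) (s : Vertex b → ℝ) :
    sumOver (I.biUnion A) (fun s => ∏ i ∈ I, w i s) s = ∏ i ∈ I, sumOver (A i) (w i) s := by
  induction I using Finset.induction_on generalizing s with
  | empty => simp [sumOver_empty]
  | insert j I hj ih =>
    have hne : ∀ i ∈ I, i ≠ j := fun i hi e => hj (e ▸ hi)
    rw [biUnion_insert, sumOver_union ((disjoint_biUnion_right _ _ _).2
      fun i hi => hA j i (hne i hi).symm), prod_insert hj]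
    have h1 : (sumOver (I.biUnion A) fun s => ∏ i ∈ insert j I, w i s)
        = fun s => w j s * ∏ i ∈ I, sumOver (A i) (w i) s := by
      funext t
      simp only [prod_insert hj]
      rw [sumOver_mul_left, ih]
      refine (hw j).mono fun v hv => ?_
      simp only [coe_biUnion, Set.mem_compl_iff, Set.mem_iUnion, not_exists]
      exact fun i hi => hB j i (hne i hi).symm v hv
    rw [h1, sumOver_mul_right]
    intro t t' ht
    refine prod_congr rfl fun i hi => ?_
    have h3 : DependsOn (sumOver (A i) (w i)) (A j : Set (Vertex b))ᶜ :=
      (sumOver_dependsOn ((hw i).mono Set.subset_union_left)).mono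
        fun v hv => hB i j (hne i hi) v hv.1
    exact h3 ht

lemma localEnergy_dependsOn (i : Fin b) (x : Vertex b) (k : ℕ) :
    DependsOn (localEnergy β h (i :: x) k) {v | i :: x <:+ v ∨ v = x} := by
  intro s s' hs
  have h1 : ∀ k, ∀ v ∈ subtree (i :: x) k, s v = s' v := fun k v hv =>
    hs v (Or.inl (mem_subtree.1 hv).1)
  unfold localEnergy
  rw [sum_congr rfl (h1 k)]
  congr 2
  refine sum_congr rfl fun v hv => ?_
  rw [h1 _ v hv]
  congr 1
  unfold parentSpin
  split_ifs with h0
  · rfl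
  · refine hs _ ?_
    by_cases e : v = i :: x
    · exact Or.inr (by rw [e]; rfl)
    · exact Or.inl (suffix_tail_of_ne (mem_subtree.1 hv).1 e)

lemma parentSpin_update_self (x : Vertex b) (s : Vertex b → ℝ) (a : ℝ) :
    parentSpin x (Function.update s x a) = parentSpin x s := by
  cases x with
  | nil => simp [parentSpin]
  | cons i x => rw [parentSpin_cons, parentSpin_cons, Function.update_of_ne (by simp)]

/-- Once the spin at x is fixed, the branches below x are independent. The formula for the branches
is an argument because it serves both as the induction hypothesis of `sumOver_subtree` and, once
proved, in `sumOver_children_eq`. -/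
lemma sumOver_children (x : Vertex b) (k : ℕ)
    (ih : ∀ (i : Fin b) (s : Vertex b → ℝ), (s x = 1 ∨ s x = -1) →
      sumOver (subtree (i :: x) k) (fun s => Real.exp (localEnergy β h (i :: x) k s)) s =
        partitionFactor β h k (i :: x) s * Real.exp (message β h k (i :: x) s * s x))
    (s : Vertex b → ℝ) {e : ℝ} (he : e = 1 ∨ e = -1) :
    sumOver (univ.biUnion fun i : Fin b => subtree (i :: x) k)
        (fun s => Real.exp (localEnergy β h x (k + 1) s)) (Function.update s x e) =
      (∏ i : Fin b, partitionFactor β h k (i :: x) s) *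
        Real.exp (e * (effectiveField β h k x s + β * parentSpin x s)) := by
  have h1 : (fun s => Real.exp (localEnergy β h x (k + 1) s)) = fun s =>
      Real.exp (s x * (β * h + β * parentSpin x s)) *
        ∏ i : Fin b, Real.exp (localEnergy β h (i :: x) k s) := by
    funext s
    rw [localEnergy_succ, Real.exp_add, Real.exp_sum]
  rw [h1, sumOver_mul_left, sumOver_biUnion_prod univ _
    (fun i j hij => disjoint_subtree_cons x k hij) _ (fun i => {v | i :: x <:+ v ∨ v = x})
    (fun i => fun s s' hs => by rw [localEnergy_dependsOn β h i x k hs])]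
  · have h2 : ∀ i : Fin b, sumOver (subtree (i :: x) k)
        (fun s => Real.exp (localEnergy β h (i :: x) k s)) (Function.update s x e) =
        partitionFactor β h k (i :: x) s * Real.exp (message β h k (i :: x) s * e) := by
      intro i
      have hc : ∀ v, i :: x <:+ v → v.length = (i :: x).length + k →
          Function.update s x e v = s v := fun v hv _ => by
        refine Function.update_of_ne ?_ _ _
        rintro rfl
        have := hv.length_le
        simp at this
      rw [ih i _ (by simpa using he), partitionFactor_congr β h k _ hc, message_congr β h k _ hc,
        Function.update_self]
    rw [prod_congr rfl fun i _ => h2 i, prod_mul_distrib, ← Real.exp_sum, ← sum_mul,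
      parentSpin_update_self, Function.update_self, effectiveField, mul_left_comm, ← Real.exp_add]
    congr 2
    ring
  · rintro i j hij v (hv | rfl) hc
    · exact hij (cons_suffix_injective hv (mem_subtree.1 hc).1)
    · have := (mem_subtree.1 hc).1.length_le
      simp at this
  · intro s s' hs
    have hx : ∀ v, v.length ≤ x.length → s v = s' v := fun v hv => hs v (by
      simp only [Set.mem_compl_iff, mem_coe, mem_biUnion, mem_univ, true_and, not_exists,
        mem_subtree, not_and]
      intro i hi
      have := hi.length_le
      simp at this
      omega)
    have h3 : parentSpin x s = parentSpin x s' := by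
      unfold parentSpin
      split_ifs
      · rfl
      · exact hx _ (by simp)
    simp only [h3, hx x le_rfl]

/-- The partition function of a subtree, as a function of the spin of the parent of its root. -/
theorem sumOver_subtree (k : ℕ) (x : Vertex b) (i : Fin b) (s : Vertex b → ℝ)
    (hs : s x = 1 ∨ s x = -1) :
    sumOver (subtree (i :: x) k) (fun s => Real.exp (localEnergy β h (i :: x) k s)) s =
      partitionFactor β h k (i :: x) s * Real.exp (message β h k (i :: x) s * s x) := by
  induction k generalizing x i s with
  | zero =>
    rw [subtree, sumOver_empty, localEnergy_zero, parentSpin_cons, partitionFactor, message]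
    ring_nf
  | succ k ih =>
    have ih' := fun (j : Fin b) (s : Vertex b → ℝ) => ih (i :: x) j s
    rw [subtree, sumOver_insert (notMem_biUnion_subtree _ k),
      sumOver_children β h (i :: x) k ih' s (Or.inl rfl),
      sumOver_children β h (i :: x) k ih' s (Or.inr rfl), parentSpin_cons, partitionFactor,
      message_succ, mul_assoc, ← two_cosh_eq β _ hs]
    ring_nf

lemma sumOver_children_eq (x : Vertex b) (k : ℕ) (s : Vertex b → ℝ) {e : ℝ}
    (he : e = 1 ∨ e = -1) :
    sumOver (univ.biUnion fun i : Fin b => subtree (i :: x) k)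
        (weight β h (subtree x (k + 1))) (Function.update s x e) =
      (∏ i : Fin b, partitionFactor β h k (i :: x) s) *
        Real.exp (e * (effectiveField β h k x s + β * parentSpin x s)) := by
  rw [← sumOver_children β h x k (fun i s => sumOver_subtree β h k x i s) s he]
  congr 1
  funext t
  exact weight_subtree β h x (Nat.succ_ne_zero k) t

/-- The law of the spin at the root `x` of a subtree, given the spins outside. -/
theorem gibbsAvg_subtree (x : Vertex b) (k : ℕ) {G : (Vertex b → ℝ) → ℝ}
    (hG : DependsOn G ((subtree x (k + 1)).erase x : Set (Vertex b))ᶜ) (s : Vertex b → ℝ) :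
    gibbsAvg β h (subtree x (k + 1)) G s =
      (G (Function.update s x 1) + G (Function.update s x (-1))) / 2 +
      Real.tanh (effectiveField β h k x s + β * parentSpin x s) *
        ((G (Function.update s x 1) - G (Function.update s x (-1))) / 2) := by
  have hU : (subtree x (k + 1)).erase x = univ.biUnion fun i : Fin b => subtree (i :: x) k := by
    rw [subtree, erase_insert (notMem_biUnion_subtree x k)]
  rw [hU] at hG
  set A := effectiveField β h k x s + β * parentSpin x s
  set P := ∏ i : Fin b, partitionFactor β h k (i :: x) s
  have hP : 0 < P := prod_pos fun i _ => partitionFactor_pos ..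
  have n1 := sumOver_children_eq β h x k s (e := 1) (Or.inl rfl)
  have n2 := sumOver_children_eq β h x k s (e := -1) (Or.inr rfl)
  have d : sumOver (subtree x (k + 1)) (weight β h (subtree x (k + 1))) s
      = P * Real.exp A + P * Real.exp (-A) := by
    conv_lhs => arg 1; rw [subtree]
    rw [sumOver_insert (notMem_biUnion_subtree _ k), n1, n2, one_mul, neg_one_mul]
  have n : sumOver (subtree x (k + 1)) (fun t => weight β h (subtree x (k + 1)) t * G t) s
      = P * Real.exp A * G (Function.update s x 1)
        + P * Real.exp (-A) * G (Function.update s x (-1)) := by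
    conv_lhs => arg 1; rw [subtree]
    rw [sumOver_insert (notMem_biUnion_subtree _ k), sumOver_mul_right hG, sumOver_mul_right hG,
      n1, n2, one_mul, neg_one_mul]
  rw [gibbsAvg, n, d, Real.tanh_eq]
  have h1 := Real.exp_pos A
  have h2 := Real.exp_pos (-A)
  field_simp
  ring

end

section

open Finset

variable {b : ℕ} (β h : ℝ)

/-! ### Decay of correlations between a vertex and the vertices far below -/

lemma gibbsAvg_congr_on {A : Finset (Vertex b)} {f g : (Vertex b → ℝ) → ℝ} {s : Vertex b → ℝ}
    (H : ∀ ξ : A → Bool, f (spinValues A s ξ) = g (spinValues A s ξ)) :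
    gibbsAvg β h A f s = gibbsAvg β h A g s := by
  simp only [gibbsAvg_eq_sum, H]

lemma spinValues_eq_or {A : Finset (Vertex b)} {v : Vertex b} (hv : v ∈ A) (s : Vertex b → ℝ)
    (ξ : A → Bool) : spinValues A s ξ v = 1 ∨ spinValues A s ξ v = -1 := by
  rw [spinValues_of_mem hv]
  cases ξ ⟨v, hv⟩ <;> simp [spin]

lemma one_sub_tanh_sq_nonneg (a : ℝ) : 0 ≤ 1 - Real.tanh a ^ 2 := by
  have := Real.tanh_sq_lt_one a
  linarith

lemma le_mul_of_sq_le_mul {p q r ε : ℝ} (hp : 0 ≤ p) (hr : 0 ≤ r) (hε : 0 ≤ ε)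
    (h1 : p ^ 2 ≤ q * r) (h2 : q ≤ ε * p) : p ≤ ε * r := by
  rcases hp.eq_or_lt with e | hpos
  · rw [← e]; positivity
  · refine le_of_mul_le_mul_left ?_ hpos
    nlinarith [mul_le_mul_of_nonneg_right h2 hr]

/-- If the posterior mean of the spin at `x` given the spins off `I` has small influence on
itself after resampling, then functions not depending on `I` are nearly uncorrelated with the
spin at `x`. -/
theorem sqNorm_le_of_influence_le (x : Vertex b) (k : ℕ) {I : Finset (Vertex b)}
    (hI : I ⊆ subtree x (k + 1)) (hx : x ∈ I) {F : (Vertex b → ℝ) → ℝ}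
    (hF : DependsOn F (I : Set (Vertex b))ᶜ) (s : Vertex b → ℝ) {ε : ℝ} (hε0 : 0 ≤ ε)
    (hε : spinDiff x (gibbsAvg β h ((subtree x (k + 1)).erase x)
      (gibbsAvg β h I fun t => t x)) s ≤ 2 * ε) :
    sqNorm β h (subtree x (k + 1)) s (fun t => gibbsAvg β h ((subtree x (k + 1)).erase x) F t
        - gibbsAvg β h (subtree x (k + 1)) F t) ≤
      ε * sqNorm β h (subtree x (k + 1)) s
        (fun t => F t - gibbsAvg β h (subtree x (k + 1)) F t) := by
  set T := subtree x (k + 1) with hT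
  set T' := T.erase x with hT'
  have hxT : x ∈ T := hI hx
  have hT'T : T' ⊆ T := erase_subset _ _
  have hTc : (T : Set (Vertex b))ᶜ ⊆ (T' : Set (Vertex b))ᶜ :=
    Set.compl_subset_compl.2 (by exact_mod_cast hT'T)
  have hTI : (T : Set (Vertex b))ᶜ ⊆ (I : Set (Vertex b))ᶜ :=
    Set.compl_subset_compl.2 (by exact_mod_cast hI)
  set G := gibbsAvg β h T' F with hG
  have hGd : DependsOn G (T' : Set (Vertex b))ᶜ := gibbsAvg_dependsOn ..
  set M := Real.tanh (effectiveField β h k x s + β * parentSpin x s) with hM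
  have hM1 : 0 ≤ 1 - M ^ 2 := one_sub_tanh_sq_nonneg _
  have law : ∀ {f : (Vertex b → ℝ) → ℝ}, DependsOn f (T' : Set (Vertex b))ᶜ →
      gibbsAvg β h T f s = (f (Function.update s x 1) + f (Function.update s x (-1))) / 2 +
        M * ((f (Function.update s x 1) - f (Function.update s x (-1))) / 2) :=
    fun hf => gibbsAvg_subtree β h x k hf s
  set a := (G (Function.update s x 1) - G (Function.update s x (-1))) / 2 with ha
  set u : (Vertex b → ℝ) → ℝ := fun t => G t - gibbsAvg β h T F t with hu
  have hud : DependsOn u (T' : Set (Vertex b))ᶜ := fun t t' ht => by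
    simp only [hu]
    rw [hGd ht, (gibbsAvg_dependsOn β h T F).mono hTc ht]
  have hET : gibbsAvg β h T F s =
      (G (Function.update s x 1) + G (Function.update s x (-1))) / 2 + M * a := by
    rw [← gibbsAvg_gibbsAvg_of_subset β h hT'T F, law hGd]
  -- A function of a two-valued spin is affine in it, so the centred `u` is a multiple of the
  -- centred spin at x.
  have hut : ∀ t, (∀ v ∉ T, t v = s v) → (t x = 1 ∨ t x = -1) → u t = a * (t x - M) := by
    intro t ht htx
    have h1 : G t = G (Function.update s x (t x)) := hGd fun v hv => by
      by_cases e : v = x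
      · subst e; simp
      · rw [Function.update_of_ne e]
        exact ht v fun hc => hv (mem_coe.2 (mem_erase.2 ⟨e, hc⟩))
    have h2 : gibbsAvg β h T F t = gibbsAvg β h T F s :=
      gibbsAvg_dependsOn β h T F fun v hv => ht v (by simpa using hv)
    simp only [hu]
    rw [h1, h2, hET]
    rcases htx with e | e <;> rw [e, ha] <;> ring
  have hcfg : ∀ ξ : T → Bool, ∀ v ∉ T, spinValues T s ξ v = s v := fun ξ v hv =>
    spinValues_of_notMem hv _ _
  have Q1 : sqNorm β h T s u = a ^ 2 * (1 - M ^ 2) := by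
    have : sqNorm β h T s u = gibbsAvg β h T (fun t => (a * (t x - M)) ^ 2) s :=
      gibbsAvg_congr_on β h fun ξ => by
        rw [hut _ (hcfg ξ) (spinValues_eq_or hxT _ _)]
    rw [this, law]
    · simp only [Function.update_self]; ring
    · intro t t' ht
      simp only [ht x (by simp [hT'])]
  set H : (Vertex b → ℝ) → ℝ := fun t => F t - gibbsAvg β h T F t with hH
  have hHd : DependsOn H (I : Set (Vertex b))ᶜ := fun t t' ht => by
    simp only [hH]
    rw [hF ht, (gibbsAvg_dependsOn β h T F).mono hTI ht]
  -- `u` is the projection of `H` onto functions that do not depend on the spins below x.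
  have Q2 : gibbsAvg β h T (fun t => u t * H t) s = sqNorm β h T s u := by
    rw [← gibbsAvg_gibbsAvg_of_subset β h hT'T, sqNorm]
    congr 1
    funext t
    rw [gibbsAvg_mul_left β h hud, hH, gibbsAvg_sub, gibbsAvg_gibbsAvg_of_superset β h hT'T,
      pow_two]
  -- `H` does not depend on the spins in `I`, so `u` may be replaced by its average over `I`.
  have Q3 : gibbsAvg β h T (fun t => u t * H t) s =
      gibbsAvg β h T (fun t => gibbsAvg β h I u t * H t) s := by
    rw [← gibbsAvg_gibbsAvg_of_subset β h hI]
    congr 1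
    funext t
    simp only [mul_comm _ (H _)]
    rw [gibbsAvg_mul_left β h hHd]
  have hIu : ∀ t, (∀ v ∉ T, t v = s v) →
      gibbsAvg β h I u t = a * (gibbsAvg β h I (fun t => t x) t - M) := by
    intro t ht
    have : gibbsAvg β h I u t = gibbsAvg β h I (fun t => a * (t x - M)) t :=
      gibbsAvg_congr_on β h fun ξ => hut _
        (fun v hv => by rw [spinValues_of_notMem fun hc => hv (hI hc), ht v hv])
        (spinValues_eq_or hx _ _)
    rw [this, gibbsAvg_smul, gibbsAvg_sub, gibbsAvg_const]
  have hxd : DependsOn (fun t : Vertex b → ℝ => t x - M) (T' : Set (Vertex b))ᶜ :=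
    fun t t' ht => by simp only [ht x (by simp [hT'])]
  -- By self-adjointness this second moment is the covariance of the spin at x with its resampled
  -- mean `w`, that is, the variance 1 - M² times half the jump of `w` in the spin at x.
  have Q4 : sqNorm β h T s (gibbsAvg β h I u) ≤ ε * sqNorm β h T s u := by
    set w := gibbsAvg β h T' (gibbsAvg β h I fun t => t x) with hw
    have hwd : DependsOn w (T' : Set (Vertex b))ᶜ := gibbsAvg_dependsOn ..
    have e1 : sqNorm β h T s (gibbsAvg β h I u) =
        a ^ 2 * gibbsAvg β h T (fun t => (t x - M) * (gibbsAvg β h I (fun t => t x) t - M)) s := by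
      rw [← gibbsAvg_smul]
      have := gibbsAvg_mul_gibbsAvg β h s hI u u
      simp only [sqNorm, pow_two] at this ⊢
      rw [← this]
      refine gibbsAvg_congr_on β h fun ξ => ?_
      rw [hIu _ (hcfg ξ), hut _ (hcfg ξ) (spinValues_eq_or hxT _ _)]
      ring
    have e2 : gibbsAvg β h T (fun t => (t x - M) * (gibbsAvg β h I (fun t => t x) t - M)) s =
        gibbsAvg β h T (fun t => (t x - M) * (w t - M)) s := by
      rw [← gibbsAvg_gibbsAvg_of_subset β h hT'T]
      congr 1
      funext t
      rw [gibbsAvg_mul_left β h hxd, gibbsAvg_sub, gibbsAvg_const]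
    have e3 : gibbsAvg β h T (fun t => (t x - M) * (w t - M)) s =
        (1 - M ^ 2) * (spinDiff x w s / 2) := by
      rw [law]
      · simp only [Function.update_self, spinDiff]; ring
      · intro t t' ht
        simp only [hwd ht, ht x (by simp [hT'])]
    rw [e1, e2, e3, Q1]
    calc a ^ 2 * ((1 - M ^ 2) * (spinDiff x w s / 2))
        = a ^ 2 * (1 - M ^ 2) / 2 * spinDiff x w s := by ring
      _ ≤ a ^ 2 * (1 - M ^ 2) / 2 * (2 * ε) :=
        mul_le_mul_of_nonneg_left hε (div_nonneg (mul_nonneg (sq_nonneg a) hM1) zero_le_two)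
      _ = ε * (a ^ 2 * (1 - M ^ 2)) := by ring
  -- Cauchy–Schwarz bounds the square of ‖u‖² by ‖E_I u‖² ‖H‖², hence by ε ‖u‖² ‖H‖²; one factor
  -- ‖u‖² is then divided out.
  have CS := sq_gibbsAvg_mul_le β h s (V := T) (gibbsAvg β h I u) H
  rw [← Q3, Q2] at CS
  have n1 : 0 ≤ sqNorm β h T s u := sqNorm_nonneg ..
  have n2 : 0 ≤ sqNorm β h T s H := sqNorm_nonneg ..
  exact le_mul_of_sq_le_mul n1 n2 hε0 CS Q4

/-! ### Influence of a spin on its children -/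

/-- The influence of the parent's spin on a spin with effective field `a`. -/
def influence (a : ℝ) : ℝ := (Real.tanh (a + β) - Real.tanh (a - β)) / 2

/-- In this form the influence is visibly positive for β > 0, even in the field and largest at field
0. -/
lemma influence_eq (a : ℝ) : influence β a =
    Real.sinh (2 * β) / (Real.cosh (2 * a) + Real.cosh (2 * β)) := by
  have h1 := Real.cosh_pos (a + β)
  have h2 := Real.cosh_pos (a - β)
  have e1 : Real.sinh (2 * β) = Real.sinh (a + β) * Real.cosh (a - β)
      - Real.cosh (a + β) * Real.sinh (a - β) := by
    rw [← Real.sinh_sub]; ring_nf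
  have e2 : Real.cosh (2 * a) + Real.cosh (2 * β)
      = 2 * (Real.cosh (a + β) * Real.cosh (a - β)) := by
    rw [show 2 * a = (a + β) + (a - β) by ring, show 2 * β = (a + β) - (a - β) by ring,
      Real.cosh_add (a + β), Real.cosh_sub (a + β)]
    ring
  rw [e1, e2, influence, Real.tanh_eq_sinh_div_cosh, Real.tanh_eq_sinh_div_cosh]
  field_simp

lemma tanh_eq_influence_zero : Real.tanh β = influence β 0 := by
  simp [influence]

variable {β}

lemma influence_nonneg (hβ : 0 ≤ β) (a : ℝ) : 0 ≤ influence β a := by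
  rw [influence_eq]
  have h1 := Real.cosh_pos (2 * a)
  have h2 := Real.cosh_pos (2 * β)
  have h3 : 0 ≤ Real.sinh (2 * β) := Real.sinh_nonneg_iff.2 (by linarith)
  positivity

lemma influence_le_tanh (hβ : 0 ≤ β) (a : ℝ) : influence β a ≤ Real.tanh β := by
  rw [tanh_eq_influence_zero, influence_eq, influence_eq]
  have h1 := Real.one_le_cosh (2 * a)
  have h2 := Real.cosh_pos (2 * β)
  have h3 : 0 ≤ Real.sinh (2 * β) := Real.sinh_nonneg_iff.2 (by linarith)
  have e : Real.cosh (2 * 0) = 1 := by simp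
  rw [e]
  gcongr

lemma tanh_nonneg (hβ : 0 ≤ β) : 0 ≤ Real.tanh β :=
  (influence_nonneg hβ 0).trans (influence_le_tanh hβ 0)

lemma continuous_influence : Continuous (influence β) := by
  have e : influence β = fun a => Real.sinh (2 * β) / (Real.cosh (2 * a) + Real.cosh (2 * β)) :=
    funext (influence_eq β)
  rw [e]
  refine continuous_const.div (by fun_prop) fun a => ?_
  have h1 := Real.cosh_pos (2 * a)
  have h2 := Real.cosh_pos (2 * β)
  positivity

/-- The influence is both the effect of a parent on its child and the slope of the field recursion.
This coincidence ties the decay of correlations to the stability of fixed points. -/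
lemma hasDerivAt_edgeMessage (a : ℝ) : HasDerivAt (edgeMessage β) (influence β a) a := by
  have h1 := Real.cosh_pos (a + β)
  have h2 := Real.cosh_pos (a - β)
  have d1 : HasDerivAt (fun a => Real.log (Real.cosh (a + β))) (Real.tanh (a + β)) a := by
    have := ((Real.hasDerivAt_cosh (a + β)).comp_add_const a β).log h1.ne'
    rwa [← Real.tanh_eq_sinh_div_cosh] at this
  have d2 : HasDerivAt (fun a => Real.log (Real.cosh (a - β))) (Real.tanh (a - β)) a := by
    have := ((Real.hasDerivAt_cosh (a - β)).comp_sub_const a β).log h2.ne'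
    rwa [← Real.tanh_eq_sinh_div_cosh] at this
  have e : edgeMessage β = fun a =>
      1 / 2 * (Real.log (Real.cosh (a + β)) - Real.log (Real.cosh (a - β))) := by
    funext a
    rw [edgeMessage, Real.log_div (Real.cosh_pos _).ne' (Real.cosh_pos _).ne']
  rw [e]
  exact ((d1.sub d2).const_mul (1 / 2)).congr_deriv (by rw [influence]; ring)

lemma abs_edgeMessage_sub_le (hβ : 0 ≤ β) (a c : ℝ) :
    |edgeMessage β a - edgeMessage β c| ≤ Real.tanh β * |a - c| := by
  have := Convex.norm_image_sub_le_of_norm_hasDerivWithin_le (s := Set.univ) (x := c) (y := a)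
    (C := Real.tanh β) (fun x _ => (hasDerivAt_edgeMessage (β := β) x).hasDerivWithinAt)
    (fun x _ => by
      rw [Real.norm_eq_abs, abs_of_nonneg (influence_nonneg hβ x)]
      exact influence_le_tanh hβ x) convex_univ trivial trivial
  simpa [Real.norm_eq_abs] using this

lemma edgeMessage_monotone (hβ : 0 ≤ β) : Monotone (edgeMessage β) :=
  monotone_of_deriv_nonneg (fun a => (hasDerivAt_edgeMessage a).differentiableAt)
    fun a => by rw [(hasDerivAt_edgeMessage a).deriv]; exact influence_nonneg hβ a

lemma abs_tanh_sub_le (a c : ℝ) : |Real.tanh a - Real.tanh c| ≤ |a - c| := by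
  have hd : ∀ x : ℝ, HasDerivAt Real.tanh (1 - Real.tanh x ^ 2) x := fun x => by
    have hc := (Real.cosh_pos x).ne'
    have := (Real.hasDerivAt_sinh x).div (Real.hasDerivAt_cosh x) hc
    have e : Real.tanh = fun x => Real.sinh x / Real.cosh x :=
      funext Real.tanh_eq_sinh_div_cosh
    have h2 : (Real.cosh x * Real.cosh x - Real.sinh x * Real.sinh x) / Real.cosh x ^ 2
        = 1 - Real.tanh x ^ 2 := by
      rw [Real.tanh_eq_sinh_div_cosh]
      field_simp
    rw [h2] at this
    rw [e]
    rwa [e] at this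
  have := Convex.norm_image_sub_le_of_norm_hasDerivWithin_le (s := Set.univ) (x := c) (y := a)
    (C := 1) (fun x _ => (hd x).hasDerivWithinAt)
    (fun x _ => by
      rw [Real.norm_eq_abs, abs_of_nonneg (one_sub_tanh_sq_nonneg x)]
      nlinarith [sq_nonneg (Real.tanh x)]) convex_univ trivial trivial
  simpa [Real.norm_eq_abs] using this

/-- Changing one spin alters a single branch at each level, and each edge contracts the change by
tanh β. -/
lemma abs_message_update_sub_le (hβ : 0 ≤ β) (k : ℕ) (x y : Vertex b) (s : Vertex b → ℝ) :
    |message β h k x (Function.update s y 1) - message β h k x (Function.update s y (-1))| ≤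
      if x <:+ y then 2 * β * Real.tanh β ^ k else 0 := by
  have ht := tanh_nonneg hβ
  induction k generalizing x with
  | zero =>
    simp only [message, pow_zero, mul_one]
    by_cases e : x = y
    · subst e
      rw [if_pos (List.suffix_refl x), Function.update_self, Function.update_self]
      rw [abs_of_nonneg (by linarith)]; linarith
    · rw [Function.update_of_ne e, Function.update_of_ne e, sub_self, abs_zero]
      split_ifs <;> positivity
  | succ k ih =>
    rw [message_succ, message_succ]
    refine (abs_edgeMessage_sub_le hβ _ _).trans ?_
    rw [effectiveField, effectiveField, add_sub_add_left_eq_sub, ← sum_sub_distrib]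
    have h1 : |∑ i : Fin b, (message β h k (i :: x) (Function.update s y 1) -
        message β h k (i :: x) (Function.update s y (-1)))| ≤
        ∑ i : Fin b, if i :: x <:+ y then 2 * β * Real.tanh β ^ k else 0 :=
      (abs_sum_le_sum_abs _ _).trans (sum_le_sum fun i _ => ih _)
    by_cases hex : ∃ i : Fin b, i :: x <:+ y
    · obtain ⟨i, hi⟩ := hex
      rw [if_pos ((List.suffix_cons i x).trans hi)]
      rw [sum_eq_single i (fun j _ hj => if_neg fun hc => hj (cons_suffix_injective hc hi))
        (by simp), if_pos hi] at h1
      calc _ ≤ Real.tanh β * (2 * β * Real.tanh β ^ k) := by gcongr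
        _ = _ := by ring
    · rw [sum_eq_zero fun i _ => if_neg fun hc => hex ⟨i, hc⟩] at h1
      have h2 := (abs_nonneg _).antisymm h1
      rw [← h2, mul_zero]
      split_ifs <;> positivity

lemma abs_effectiveField_update_sub_le (hβ : 0 ≤ β) (k : ℕ) (x y : Vertex b) (s : Vertex b → ℝ) :
    |effectiveField β h k x (Function.update s y 1) -
      effectiveField β h k x (Function.update s y (-1))| ≤ 2 * β * Real.tanh β ^ k := by
  have ht := tanh_nonneg hβ
  rw [effectiveField, effectiveField, add_sub_add_left_eq_sub, ← sum_sub_distrib]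
  have h1 : |∑ i : Fin b, (message β h k (i :: x) (Function.update s y 1) -
      message β h k (i :: x) (Function.update s y (-1)))| ≤
      ∑ i : Fin b, if i :: x <:+ y then 2 * β * Real.tanh β ^ k else 0 :=
    (abs_sum_le_sum_abs _ _).trans (sum_le_sum fun i _ => abs_message_update_sub_le h hβ ..)
  refine h1.trans ?_
  by_cases hex : ∃ i : Fin b, i :: x <:+ y
  · obtain ⟨i, hi⟩ := hex
    rw [sum_eq_single i (fun j _ hj => if_neg fun hc => hj (cons_suffix_injective hc hi))
      (by simp), if_pos hi]
  · rw [sum_eq_zero fun i _ => if_neg fun hc => hex ⟨i, hc⟩]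
    positivity

/-- The mean of the spin at the root of a subtree given the spins outside. -/
lemma gibbsAvg_subtree_spin (x : Vertex b) (k : ℕ) (s : Vertex b → ℝ) :
    gibbsAvg β h (subtree x (k + 1)) (fun t => t x) s =
      Real.tanh (effectiveField β h k x s + β * parentSpin x s) := by
  rw [gibbsAvg_subtree]
  · simp
  · intro t t' ht
    exact ht x (by simp)

lemma abs_spinDiff_gibbsAvg_subtree_spin_le (hβ : 0 ≤ β) (x y : Vertex b) (k : ℕ)
    (hy : y.length = x.length + (k + 1)) (s : Vertex b → ℝ) :
    |spinDiff y (gibbsAvg β h (subtree x (k + 1)) fun t => t x) s| ≤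
      2 * β * Real.tanh β ^ k := by
  have hp : ∀ a, parentSpin x (Function.update s y a) = parentSpin x s := fun a => by
    unfold parentSpin
    split_ifs
    · rfl
    · refine Function.update_of_ne (fun e => ?_) _ _
      have := congrArg List.length e
      simp at this
      omega
  rw [spinDiff, gibbsAvg_subtree_spin, gibbsAvg_subtree_spin, hp, hp]
  refine (abs_tanh_sub_le _ _).trans ?_
  rw [add_sub_add_right_eq_sub]
  exact abs_effectiveField_update_sub_le h hβ k x y s

end

/-! ### Propagation of the influence of a spin down the tree -/

section

open Finset

variable {b : ℕ} {β : ℝ} (h : ℝ)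

lemma mem_completeTree {m : ℕ} {v : Vertex b} : v ∈ completeTree b m ↔ v.length ≤ m := by
  simp [completeTree]

lemma desc_completeTree {m : ℕ} {x : Vertex b} (hx : x ∈ completeTree b m) :
    desc (completeTree b m) x = subtree x (m - x.length + 1) := by
  rw [mem_completeTree] at hx
  ext v
  rw [mem_desc, mem_completeTree, mem_subtree]
  constructor
  · rintro ⟨h1, h2⟩; exact ⟨h2, by omega⟩
  · rintro ⟨h1, h2⟩; exact ⟨by omega, h1⟩

lemma effectiveField_eq_of_agree {m : ℕ} {x : Vertex b} (hx : x ∈ completeTree b m)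
    {s s' : Vertex b → ℝ} (hs : ∀ v ∉ completeTree b m, s v = s' v) :
    effectiveField β h (m - x.length) x s = effectiveField β h (m - x.length) x s' := by
  rw [mem_completeTree] at hx
  refine effectiveField_congr β h _ x fun v _ hl => hs v ?_
  rw [mem_completeTree]; omega

lemma update_agree {V : Finset (Vertex b)} {s s₀ : Vertex b → ℝ} (hs : ∀ v ∉ V, s v = s₀ v)
    {y : Vertex b} (hy : y ∈ V) (a : ℝ) : ∀ v ∉ V, Function.update s y a v = s₀ v := fun v hv => by
  rw [Function.update_of_ne (fun e : v = y => hv (by rwa [e])), hs v hv]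

lemma abs_average_le {M A B d : ℝ} (hM : |M| ≤ 1) (hA : |A| ≤ d) (hB : |B| ≤ d) :
    |(A + B) / 2 + M * ((A - B) / 2)| ≤ d := by
  rw [abs_le] at *
  constructor <;> nlinarith

/-- Averaging over the descendants of `y` moves the influence of the spin at `y` to the spin at
its parent, with a factor `κ`. -/
lemma abs_spinDiff_gibbsAvg_desc_le {m : ℕ} {i : Fin b} {z : Vertex b}
    (hy : i :: z ∈ completeTree b m) {s₀ : Vertex b → ℝ} {κ : ℝ}
    (hκ : influence β (effectiveField β h (m - (i :: z).length) (i :: z) s₀) ≤ κ) (hβ : 0 ≤ β)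
    {G : (Vertex b → ℝ) → ℝ}
    (hG : DependsOn G ((desc (completeTree b m) (i :: z)).erase (i :: z) : Set (Vertex b))ᶜ)
    {v : Vertex b} (hv : v ∈ completeTree b m) (hvy : v ∉ desc (completeTree b m) (i :: z))
    {δ δ' : ℝ}
    (hδ : ∀ s, (∀ v ∉ completeTree b m, s v = s₀ v) → |spinDiff v G s| ≤ δ)
    (hδ' : ∀ s, (∀ v ∉ completeTree b m, s v = s₀ v) → |spinDiff (i :: z) G s| ≤ δ')
    {s : Vertex b → ℝ} (hs : ∀ v ∉ completeTree b m, s v = s₀ v) :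
    |spinDiff v (gibbsAvg β h (desc (completeTree b m) (i :: z)) G) s| ≤
      δ + if v = z then κ * δ' else 0 := by
  set y := i :: z with hydef
  have hvy' : v ≠ y := by
    rintro rfl
    exact hvy (self_mem_desc hy)
  rw [desc_completeTree hy] at hG ⊢
  set k := m - y.length
  set a := effectiveField β h k y s₀ with ha
  have hfield : ∀ t, (∀ v ∉ completeTree b m, t v = s₀ v) → effectiveField β h k y t = a :=
    fun t ht => effectiveField_eq_of_agree h hy ht
  have d1 := update_agree hs hv 1
  have d2 := update_agree hs hv (-1)
  rw [spinDiff, gibbsAvg_subtree β h y k hG, gibbsAvg_subtree β h y k hG, hfield _ d1,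
    hfield _ d2, parentSpin_cons, parentSpin_cons]
  have c1 := hδ _ (update_agree hs hy 1)
  have c2 := hδ _ (update_agree hs hy (-1))
  have c3 := hδ' _ d2
  simp only [spinDiff, Function.update_comm hvy'] at c1 c2 c3
  simp only [Function.update_comm hvy']
  set Gpp := G (Function.update (Function.update s y 1) v 1)
  set Gpm := G (Function.update (Function.update s y 1) v (-1))
  set Gmp := G (Function.update (Function.update s y (-1)) v 1)
  set Gmm := G (Function.update (Function.update s y (-1)) v (-1))
  split_ifs with e
  · subst e
    rw [Function.update_self, Function.update_self]
    have hin0 := influence_nonneg hβ a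
    have hin : Real.tanh (a + β * 1) - Real.tanh (a + β * -1) = 2 * influence β a := by
      rw [influence, mul_one, mul_neg_one, ← sub_eq_add_neg]; ring
    have hb := abs_average_le (Real.abs_tanh_lt_one (a + β * 1)).le c1 c2
    -- The spin at v = z acts in two ways: directly through G, averaged over the spin at y with one
    -- fixed law, and by shifting the law of the spin at y, which costs the influence times the jump
    -- of G at y.
    have key : (Gpp + Gmp) / 2 + Real.tanh (a + β * 1) * ((Gpp - Gmp) / 2) -
        ((Gpm + Gmm) / 2 + Real.tanh (a + β * -1) * ((Gpm - Gmm) / 2)) =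
        ((Gpp - Gpm) + (Gmp - Gmm)) / 2 +
          Real.tanh (a + β * 1) * (((Gpp - Gpm) - (Gmp - Gmm)) / 2) +
        influence β a * (Gpm - Gmm) := by
      linear_combination ((Gpm - Gmm) / 2) * hin
    rw [key]
    refine (abs_add_le _ _).trans (add_le_add hb ?_)
    rw [abs_mul, abs_of_nonneg hin0]
    exact mul_le_mul hκ c3 (abs_nonneg _) (hin0.trans hκ)
  · rw [Function.update_of_ne (Ne.symm e), Function.update_of_ne (Ne.symm e), add_zero]
    have hb := abs_average_le (Real.abs_tanh_lt_one (a + β * s z)).le c1 c2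
    refine le_trans (le_of_eq ?_) hb
    congr 1
    ring

/-- Average out the vertices one at a time from the bottom. Removing y adds κ times its bound to
that of its parent, so the sum of the bounds weighted by κ to the depth below x does not grow; at
the end only the bound at x is left. -/
theorem abs_spinDiff_gibbsAvg_le_sum (hβ : 0 ≤ β) {m : ℕ} {x : Vertex b}
    (hx : x ∈ completeTree b m) {s₀ : Vertex b → ℝ} {κ : ℝ} (hκ0 : 0 ≤ κ) {ℓ : ℕ}
    (hκ : ∀ y ∈ completeTree b m, y.length ≤ x.length + ℓ →
      influence β (effectiveField β h (m - y.length) y s₀) ≤ κ)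
    {g : (Vertex b → ℝ) → ℝ}
    (hg : DependsOn g
      ((desc (completeTree b m) x).filter fun v => x.length + ℓ < v.length : Set (Vertex b))ᶜ)
    {δ : Vertex b → ℝ} (hδ0 : ∀ v, 0 ≤ δ v)
    (hδ : ∀ v ∈ desc (completeTree b m) x, v.length ≤ x.length + ℓ →
      ∀ s, (∀ v ∉ completeTree b m, s v = s₀ v) → |spinDiff v g s| ≤ δ v)
    {s : Vertex b → ℝ} (hs : ∀ v ∉ completeTree b m, s v = s₀ v) :
    |spinDiff x (gibbsAvg β h ((desc (completeTree b m) x).erase x) g) s| ≤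
      ∑ v ∈ (desc (completeTree b m) x).filter (fun v => v.length ≤ x.length + ℓ),
        κ ^ (v.length - x.length) * δ v := by
  set V := completeTree b m with hV
  set D := (desc V x).filter fun v => x.length + ℓ < v.length with hD
  set C := (desc V x).erase x with hC
  set N := (desc V x).filter (fun v => v.length ≤ x.length + ℓ) with hN
  have hxN : x ∈ N := mem_filter.2 ⟨self_mem_desc hx, by omega⟩
  have hDC : D ⊆ C := fun v hv => by
    rw [hD, mem_filter] at hv
    refine mem_erase.2 ⟨?_, hv.1⟩
    rintro rfl; omega
  have hDcl : DescClosed V D := by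
    refine ⟨(filter_subset _ _).trans (desc_subset x), fun v hv w hw hvw => ?_⟩
    rw [hD, mem_filter] at hv ⊢
    exact ⟨(descClosed_desc x).2 v hv.1 w hw hvw, hv.2.trans_le hvw.length_le⟩
  have key := hDcl.induction (descClosed_desc_erase x) hDC
    (fun D' => ∃ δ' : Vertex b → ℝ, (∀ v, 0 ≤ δ' v) ∧
      (∀ v ∈ N, v ∉ D' → ∀ s, (∀ v ∉ V, s v = s₀ v) → |spinDiff v (gibbsAvg β h D' g) s| ≤ δ' v) ∧
      ∑ v ∈ N \ D', κ ^ (v.length - x.length) * δ' v ≤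
        ∑ v ∈ N, κ ^ (v.length - x.length) * δ v) ?_ ?_
  · obtain ⟨δ', -, h2, h3⟩ := key
    have hxC : x ∈ N \ C := mem_sdiff.2 ⟨hxN, by simp [hC]⟩
    refine (h2 x hxN (by simp) s hs).trans (le_trans ?_ h3)
    have e : N \ C = {x} := by
      ext v
      simp only [hC, hN, mem_sdiff, mem_filter, mem_erase, mem_singleton]
      constructor
      · rintro ⟨⟨h1, -⟩, h2⟩
        by_contra hne
        exact h2 ⟨hne, h1⟩
      · rintro rfl
        exact ⟨⟨self_mem_desc hx, by omega⟩, by simp⟩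
    rw [e, sum_singleton]
    simp
  · refine ⟨δ, hδ0, fun v hv _ s hs => ?_, ?_⟩
    · rw [gibbsAvg_of_dependsOn β h hg]
      rw [hN, mem_filter] at hv
      exact hδ v hv.1 hv.2 s hs
    · exact sum_le_sum_of_subset_of_nonneg sdiff_subset fun v _ _ =>
        mul_nonneg (pow_nonneg hκ0 _) (hδ0 v)
  · rintro D' y hD' hDD' hD'C hyC hyD' hsub ⟨δ', h1, h2, h3⟩
    have hyx : y ≠ x := (mem_erase.1 hyC).1
    have hyT : y ∈ desc V x := (mem_erase.1 hyC).2
    have hyV : y ∈ V := desc_subset x hyT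
    have hyl : y.length ≤ x.length + ℓ := by
      by_contra hc
      exact hyD' (hDD' (mem_filter.2 ⟨hyT, by omega⟩))
    have hyN : y ∈ N := mem_filter.2 ⟨hyT, hyl⟩
    obtain ⟨i, z, rfl⟩ : ∃ i z, y = i :: z := by
      cases y with
      | nil => exact absurd (List.suffix_nil.1 (mem_desc.1 hyT).2).symm hyx
      | cons i z => exact ⟨i, z, rfl⟩
    have hxz : x <:+ z := suffix_tail_of_ne (mem_desc.1 hyT).2 hyx
    have hzV : z ∈ V := by
      rw [hV, mem_completeTree] at hyV ⊢
      simp only [List.length_cons] at hyV; omega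
    have hzN : z ∈ N := mem_filter.2 ⟨mem_desc.2 ⟨hzV, hxz⟩, by
      simp only [List.length_cons] at hyl; omega⟩
    have hzD' : z ∉ D' := fun hc => hyD' (hD'.2 z hc _ hyV (List.suffix_cons i z))
    -- Averages over the subtree at y and over the part of `D'` outside it commute; this brings the
    -- new average to the outside, as the one-step estimate requires.
    have hsplit : gibbsAvg β h (insert (i :: z) D') g =
        gibbsAvg β h (desc V (i :: z)) (gibbsAvg β h D' g) := by
      rw [gibbsAvg_eq_erase β h hD' hyV hyD' hsub,
        gibbsAvg_comm β h ((separated_desc hD' hyV hyD').symm),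
        gibbsAvg_gibbsAvg_of_subset β h (erase_subset _ _), gibbsAvg_insert_eq β h hD' hyV hyD' hsub]
    refine ⟨fun v => δ' v + if v = z then κ * δ' (i :: z) else 0, fun v => ?_, ?_, ?_⟩
    · have := h1 v
      have := mul_nonneg hκ0 (h1 (i :: z))
      dsimp only
      split_ifs <;> positivity
    · intro v hv hvD s hs
      rw [hsplit]
      have hvD' : v ∉ D' := fun hc => hvD (mem_insert_of_mem hc)
      have hvy : v ∉ desc V (i :: z) := fun hc => hvD (by
        by_cases e : v = i :: z
        · simp [e]
        · exact mem_insert_of_mem (hsub (mem_erase.2 ⟨e, hc⟩)))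
      refine abs_spinDiff_gibbsAvg_desc_le h hyV (hκ _ hyV hyl) hβ ?_
        (desc_subset x (mem_filter.1 hv).1) hvy
        (fun s hs => h2 v hv hvD' s hs) (fun s hs => h2 _ hyN hyD' s hs) hs
      exact (gibbsAvg_dependsOn β h D' g).mono (Set.compl_subset_compl.2 (by exact_mod_cast hsub))
    · refine le_trans (le_of_eq ?_) h3
      have hzM : z ∈ N \ insert (i :: z) D' := mem_sdiff.2 ⟨hzN, by
        simp only [mem_insert, not_or]
        exact ⟨by simp, hzD'⟩⟩
      have hyM : i :: z ∈ N \ D' := mem_sdiff.2 ⟨hyN, hyD'⟩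
      simp only [mul_add, sum_add_distrib, mul_ite, mul_zero, sum_ite_eq', hzM, if_true]
      rw [sdiff_insert, ← add_sum_erase _ _ hyM, add_comm]
      congr 1
      have := hxz.length_le
      rw [List.length_cons, Nat.succ_sub this, pow_succ]
      ring

end

section

open Finset

variable {b : ℕ} {β : ℝ} (h : ℝ)

/-! ### The variance is bounded by the sum of the single-site variances -/

lemma card_subtree_le (x : Vertex b) (k : ℕ) : (subtree x k).card ≤ (b + 1) ^ k := by
  induction k generalizing x with
  | zero => simp [subtree]
  | succ k ih =>
    rw [subtree, card_insert_of_notMem (notMem_biUnion_subtree x k)]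
    have : (univ.biUnion fun i : Fin b => subtree (i :: x) k).card ≤ b * (b + 1) ^ k := by
      simpa using card_biUnion_le_card_mul univ (fun i : Fin b => subtree (i :: x) k) _
        fun i _ => ih _
    have h1 : 1 ≤ (b + 1) ^ k := Nat.one_le_pow _ _ (by omega)
    rw [pow_succ]
    nlinarith

lemma card_level_le {V : Finset (Vertex b)} (x : Vertex b) (k : ℕ) :
    ((desc V x).filter fun v => v.length = x.length + k).card ≤ b ^ k := by
  have hsub : ((desc V x).filter fun v => v.length = x.length + k) ⊆
      (univ : Finset (Fin k → Fin b)).image fun t => List.ofFn t ++ x := by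
    intro v hv
    rw [mem_filter, mem_desc] at hv
    obtain ⟨⟨-, t, rfl⟩, hl⟩ := hv
    have ht : t.length = k := by simp at hl; omega
    subst ht
    exact mem_image.2 ⟨t.get, mem_univ _, by simp⟩
  exact (card_le_card hsub).trans (card_image_le.trans (by simp))

/-- After exchanging the sums, each y is counted once for each ancestor (itself included) at
distance less than n, of which there are at most n. -/
lemma sum_desc_le {V : Finset (Vertex b)} (n : ℕ) {a : Vertex b → ℝ} (ha : ∀ v, 0 ≤ a v) :
    ∑ x ∈ V, ∑ y ∈ (desc V x).filter (fun y => y.length < x.length + n), a y ≤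
      n * ∑ y ∈ V, a y := by
  have e : ∑ x ∈ V, ∑ y ∈ (desc V x).filter (fun y => y.length < x.length + n), a y =
      ∑ y ∈ V, ∑ x ∈ V.filter (fun x => x <:+ y ∧ y.length < x.length + n), a y := by
    refine sum_comm' fun x y => ?_
    simp only [mem_filter, mem_desc]
    tauto
  rw [e, mul_sum]
  refine sum_le_sum fun y _ => ?_
  rw [sum_const, nsmul_eq_mul]
  refine mul_le_mul_of_nonneg_right ?_ (ha y)
  have hsub : V.filter (fun x => x <:+ y ∧ y.length < x.length + n) ⊆
      (range n).image fun j => y.drop j := by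
    intro x hx
    rw [mem_filter] at hx
    obtain ⟨-, ⟨t, rfl⟩, hl⟩ := hx
    refine mem_image.2 ⟨t.length, mem_range.2 ?_, by simp⟩
    simp at hl; omega
  exact_mod_cast (card_le_card hsub).trans (card_image_le.trans (by simp))

variable {m : ℕ} {s₀ : Vertex b → ℝ}

/-- A bound for the correlation between a spin and the spins `k + 1` levels below. -/
def decayRate (b : ℕ) (β κ : ℝ) (k : ℕ) : ℝ := (b * κ * Real.tanh β) ^ k * (b * κ * β)

/-- At most b ^ (k + 1) vertices lie k + 1 levels below x. The spin at x influences each by κ ^ (k +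
1), and each in turn moves the posterior mean at x by at most 2 β (tanh β) ^ k. -/
lemma spinDiff_posterior_le (hβ : 0 ≤ β) {x : Vertex b} (hx : x ∈ completeTree b m) {κ : ℝ}
    (hκ0 : 0 ≤ κ) {k : ℕ}
    (hκ : ∀ y ∈ completeTree b m, y.length ≤ x.length + (k + 1) →
      influence β (effectiveField β h (m - y.length) y s₀) ≤ κ)
    {s : Vertex b → ℝ} (hs : ∀ v ∉ completeTree b m, s v = s₀ v) :
    |spinDiff x (gibbsAvg β h ((desc (completeTree b m) x).erase x)
      (gibbsAvg β h (subtree x (k + 1)) fun t => t x)) s| ≤ 2 * decayRate b β κ k := by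
  have ht := tanh_nonneg hβ
  refine (abs_spinDiff_gibbsAvg_le_sum h hβ hx hκ0 (ℓ := k + 1) hκ
    (δ := fun v => if v.length = x.length + (k + 1) then 2 * β * Real.tanh β ^ k else 0)
    ?_ ?_ ?_ hs).trans ?_
  · intro s s' hs
    have h1 : ∀ v : Vertex b, v.length ≤ x.length + (k + 1) → s v = s' v := fun v hv => hs v (by
      simp only [coe_filter, Set.mem_compl_iff, Set.mem_ofPred_eq, not_and, not_lt]
      exact fun _ => hv)
    rw [gibbsAvg_subtree_spin, gibbsAvg_subtree_spin,
      effectiveField_congr β h k x fun v _ hl => h1 v hl.le]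
    have h2 : parentSpin x s = parentSpin x s' := by
      unfold parentSpin
      split_ifs
      · rfl
      · exact h1 _ (by simp; omega)
    rw [h2]
  · intro v
    split_ifs <;> positivity
  · intro v hv hl s _
    split_ifs with e
    · exact abs_spinDiff_gibbsAvg_subtree_spin_le h hβ x v k e s
    · have hvB : v ∈ subtree x (k + 1) := mem_subtree.2 ⟨(mem_desc.1 hv).2, by omega⟩
      have : gibbsAvg β h (subtree x (k + 1)) (fun t => t x) (Function.update s v 1) =
          gibbsAvg β h (subtree x (k + 1)) (fun t => t x) (Function.update s v (-1)) :=
        gibbsAvg_dependsOn β h _ _ fun w hw => by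
          have : w ≠ v := by rintro rfl; exact hw (mem_coe.2 hvB)
          rw [Function.update_of_ne this, Function.update_of_ne this]
      rw [spinDiff, this, sub_self, abs_zero]
  · simp only [mul_ite, mul_zero]
    rw [← sum_filter, filter_filter]
    have e1 : ((desc (completeTree b m) x).filter fun v =>
        v.length ≤ x.length + (k + 1) ∧ v.length = x.length + (k + 1)) =
        (desc (completeTree b m) x).filter fun v => v.length = x.length + (k + 1) := by
      refine filter_congr fun v _ => ⟨fun h => h.2, fun h => ⟨h.le, h⟩⟩
    rw [e1]
    have e2 : ∀ v ∈ (desc (completeTree b m) x).filter (fun v => v.length = x.length + (k + 1)),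
        κ ^ (v.length - x.length) * (2 * β * Real.tanh β ^ k) =
          κ ^ (k + 1) * (2 * β * Real.tanh β ^ k) := fun v hv => by
      rw [(mem_filter.1 hv).2, Nat.add_sub_cancel_left]
    rw [sum_congr rfl e2, sum_const, nsmul_eq_mul]
    have hc : ((((desc (completeTree b m) x).filter fun v =>
        v.length = x.length + (k + 1)).card : ℕ) : ℝ) ≤ (b : ℝ) ^ (k + 1) := by
      exact_mod_cast card_level_le x (k + 1)
    calc _ ≤ (b : ℝ) ^ (k + 1) * (κ ^ (k + 1) * (2 * β * Real.tanh β ^ k)) := by gcongr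
      _ = _ := by rw [decayRate, mul_pow, mul_pow, pow_succ, pow_succ]; ring

lemma decayRate_nonneg (hβ : 0 ≤ β) {κ : ℝ} (hκ0 : 0 ≤ κ) (k : ℕ) : 0 ≤ decayRate b β κ k := by
  have := tanh_nonneg hβ
  unfold decayRate
  positivity

/-- The part f - E_B f is kept as it is, to be bounded later by block variances. For E_B f, the
average F over B and over everything deeper than level k + 1 is weakly correlated with the spin at
x, and the variance of F is bounded by the site variances at the levels not averaged in D. -/
theorem siteVar_le (hβ : 0 ≤ β) {x : Vertex b} {κ : ℝ} (hκ0 : 0 ≤ κ) {k : ℕ}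
    (hx : x.length + (k + 1) ≤ m)
    (hκ : ∀ y ∈ completeTree b m, y.length ≤ x.length + (k + 1) →
      influence β (effectiveField β h (m - y.length) y s₀) ≤ κ)
    (f : (Vertex b → ℝ) → ℝ) :
    siteVar β h (completeTree b m) s₀ f x ≤
      2 * sqNorm β h (completeTree b m) s₀ (fun s => f s - gibbsAvg β h (subtree x (k + 1)) f s) +
      2 * decayRate b β κ k * ∑ y ∈ (desc (completeTree b m) x).filter
        (fun y => y.length < x.length + (k + 2)), siteVar β h (completeTree b m) s₀ f y := by
  have hxV : x ∈ completeTree b m := mem_completeTree.2 (by omega)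
  have hTeq := desc_completeTree hxV
  set V := completeTree b m with hV
  set T := desc V x with hT
  set B := subtree x (k + 1) with hB
  set D := T.filter fun v => x.length + (k + 1) < v.length with hD
  set T' := T.erase x with hT'
  have hTV : T ⊆ V := desc_subset x
  have hT'T : T' ⊆ T := erase_subset _ _
  have hBT : B ⊆ T := fun v hv => by
    rw [hB, mem_subtree] at hv
    exact mem_desc.2 ⟨mem_completeTree.2 (by omega), hv.1⟩
  have hDT : D ⊆ T := filter_subset _ _
  have hDT' : D ⊆ T' := fun v hv => by
    refine mem_erase.2 ⟨?_, hDT hv⟩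
    rintro rfl
    have := (mem_filter.1 hv).2
    omega
  have hxB : x ∈ B := mem_subtree.2 ⟨List.suffix_refl x, by omega⟩
  have hsep : Separated B D := by
    refine ⟨disjoint_left.2 fun v hv hv' => ?_, fun v hv _ hc => ?_, fun v hv _ hc => ?_⟩
    · have := (mem_subtree.1 hv).2
      have := (mem_filter.1 hv').2
      omega
    · have h1 := (mem_subtree.1 hv).2
      have h2 := (mem_filter.1 hc).2
      rw [List.length_tail] at h2
      omega
    · have h1 := (mem_subtree.1 hc).2
      have h2 := (mem_filter.1 hv).2
      rw [List.length_tail] at h1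
      omega
  have hDcl : DescClosed V D := by
    refine ⟨hDT.trans hTV, fun v hv w hw hvw => ?_⟩
    rw [hD, mem_filter] at hv ⊢
    exact ⟨(descClosed_desc x).2 v hv.1 w hw hvw, hv.2.trans_le hvw.length_le⟩
  have hIT : B ∪ D ⊆ T := union_subset hBT hDT
  set F := gibbsAvg β h (B ∪ D) f with hF
  have hFB : gibbsAvg β h T' (gibbsAvg β h B f) = gibbsAvg β h T' F := by
    rw [hF, union_comm, gibbsAvg_union β h hsep.symm, gibbsAvg_gibbsAvg_of_subset β h hDT']
  have hTF : gibbsAvg β h T F = gibbsAvg β h T f := gibbsAvg_gibbsAvg_of_subset β h hIT f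
  have hTB : gibbsAvg β h T (gibbsAvg β h B f) = gibbsAvg β h T f :=
    gibbsAvg_gibbsAvg_of_subset β h hBT f
  set g : (Vertex b → ℝ) → ℝ := fun s => f s - gibbsAvg β h B f s with hg
  have hsplit : (fun s => gibbsAvg β h T' f s - gibbsAvg β h T f s) = fun s =>
      (gibbsAvg β h T' g s - gibbsAvg β h T g s) +
        (gibbsAvg β h T' F s - gibbsAvg β h T F s) := by
    funext s
    rw [hg, gibbsAvg_sub, gibbsAvg_sub, hFB, hTB, hTF]
    ring
  have h1 : sqNorm β h V s₀ (fun s => gibbsAvg β h T' g s - gibbsAvg β h T g s) ≤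
      sqNorm β h V s₀ g := by
    rw [sqNorm_gibbsAvg_sub β h s₀ hT'T hTV]
    have := sqNorm_gibbsAvg_le β h s₀ (hT'T.trans hTV) g
    have := sqNorm_nonneg β h V s₀ (gibbsAvg β h T g)
    linarith
  have hε0 := decayRate_nonneg (b := b) hβ hκ0 k
  have h2 : sqNorm β h V s₀ (fun s => gibbsAvg β h T' F s - gibbsAvg β h T F s) ≤
      decayRate b β κ k * sqNorm β h V s₀ (fun s => F s - gibbsAvg β h T F s) := by
    unfold sqNorm
    rw [← gibbsAvg_gibbsAvg_of_subset β h hTV, ← gibbsAvg_smul,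
      ← gibbsAvg_gibbsAvg_of_subset β h hTV (fun s => _ * _)]
    refine gibbsAvg_mono β h fun ξ => ?_
    rw [gibbsAvg_smul]
    have hagree : ∀ v ∉ V, spinValues V s₀ ξ v = s₀ v := fun v hv => spinValues_of_notMem hv _ _
    have hinf := (le_abs_self _).trans
      (spinDiff_posterior_le h hβ hxV hκ0 (k := k) hκ hagree)
    -- Given the spins at level k + 1, those below it carry no further information about x, so
    -- resampling on `B ∪ D` acts on the spin at x as on `B`.
    have hI : gibbsAvg β h (B ∪ D) (fun t => t x) = gibbsAvg β h B fun t => t x := by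
      rw [gibbsAvg_union β h hsep]
      congr 1
      refine gibbsAvg_of_dependsOn β h fun t t' ht => ht x ?_
      simp only [Set.mem_compl_iff, mem_coe]
      exact fun hc => disjoint_left.1 hsep.1 hxB hc
    have := sqNorm_le_of_influence_le β h x (m - x.length) (I := B ∪ D) (F := F)
      (hTeq ▸ hIT) (mem_union_left _ hxB) (gibbsAvg_dependsOn ..) (spinValues V s₀ ξ) hε0
      (by rw [← hTeq, hI]; exact hinf)
    rw [← hTeq] at this
    exact this
  have h3 : sqNorm β h V s₀ (fun s => F s - gibbsAvg β h T F s) ≤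
      ∑ y ∈ T.filter (fun y => y.length < x.length + (k + 2)), siteVar β h V s₀ f y := by
    have e : T \ D = T.filter (fun y => y.length < x.length + (k + 2)) := by
      ext v
      simp only [hD, mem_sdiff, mem_filter, not_and, not_lt]
      constructor
      · rintro ⟨a1, a2⟩; exact ⟨a1, by have := a2 a1; omega⟩
      · rintro ⟨a1, a2⟩; exact ⟨a1, fun _ => by omega⟩
    rw [hTF, hF, sqNorm_gibbsAvg_sub β h s₀ hIT hTV, gibbsAvg_union β h hsep, ← e]
    have a1 := sqNorm_sub_le_sum_siteVar β h s₀ hDcl (descClosed_desc x) hDT f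
    have a2 := sqNorm_gibbsAvg_le β h s₀ (hBT.trans hTV) (gibbsAvg β h D f)
    linarith
  rw [siteVar, hsplit]
  refine (sqNorm_add_le β h s₀ _ _).trans ?_
  have h4 := h2.trans (mul_le_mul_of_nonneg_left h3 hε0)
  linarith

/-- Constant in the Poincaré inequality. -/
def poincareConst (b : ℕ) (β h : ℝ) (L : ℕ) : ℝ := 4 * L * blockConst b β h ((b + 1) ^ L)

/-- Sum the bounds on the site variances over x. The site variances reappear on the right with total
factor at most 1/2 and are absorbed, leaving single-site variances, each counted at most L times. -/
theorem poincare (hβ : 0 ≤ β) (hs : ∀ v, |s₀ v| ≤ 1) {κ : ℝ} (hκ0 : 0 ≤ κ) {k ℓ₀ : ℕ}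
    (hκ : ∀ y : Vertex b, y.length + ℓ₀ ≤ m →
      influence β (effectiveField β h (m - y.length) y s₀) ≤ κ)
    (hk : 2 * decayRate b β κ k * ((k + 2 : ℕ) : ℝ) ≤ 1 / 2) (f : (Vertex b → ℝ) → ℝ) :
    sqNorm β h (completeTree b m) s₀
        (fun s => f s - gibbsAvg β h (completeTree b m) f s) ≤
      poincareConst b β h (k + 1 + ℓ₀) * ∑ y ∈ completeTree b m,
        sqNorm β h (completeTree b m) s₀ (fun s => f s - gibbsAvg β h {y} f s) := by
  set V := completeTree b m with hV
  set L := k + 1 + ℓ₀ with hL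
  set K := (b + 1) ^ L with hK
  have hC := blockConst_pos (b := b) β h K
  set C := blockConst b β h K with hCdef
  set Z := siteVar β h V s₀ f with hZ
  have hZ0 : ∀ y, 0 ≤ Z y := siteVar_nonneg β h s₀ f
  set q : Vertex b → ℝ := fun y => sqNorm β h V s₀ (fun s => f s - gibbsAvg β h {y} f s) with hq
  have hq0 : ∀ y, 0 ≤ q y := fun y => sqNorm_nonneg ..
  have hε0 := decayRate_nonneg (b := b) hβ hκ0 k
  have block : ∀ A : Finset (Vertex b), ∀ x, A ⊆ (desc V x).filter
      (fun y => y.length < x.length + L) → A.card ≤ K →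
      sqNorm β h V s₀ (fun s => f s - gibbsAvg β h A f s) ≤
        C * ∑ y ∈ (desc V x).filter (fun y => y.length < x.length + L), q y := by
    intro A x hA hAK
    refine (block_poincare β h (hA.trans ((filter_subset _ _).trans (desc_subset x))) hAK f
      hs).trans ?_
    exact mul_le_mul_of_nonneg_left (sum_le_sum_of_subset_of_nonneg hA fun y _ _ => hq0 y) hC.le
  have site : ∀ x ∈ V, Z x ≤
      2 * C * ∑ y ∈ (desc V x).filter (fun y => y.length < x.length + L), q y +
      2 * decayRate b β κ k *
        ∑ y ∈ (desc V x).filter (fun y => y.length < x.length + (k + 2)), Z y := by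
    intro x hx
    have hx' := mem_completeTree.1 hx
    by_cases hxm : x.length + L ≤ m
    · have a1 := siteVar_le (m := m) (s₀ := s₀) h hβ (x := x) hκ0 (k := k) (by omega)
        (fun y _ hyl => hκ y (by omega)) f
      have a2 := block (subtree x (k + 1)) x (fun v hv => by
          rw [mem_subtree] at hv
          exact mem_filter.2 ⟨mem_desc.2 ⟨mem_completeTree.2 (by omega), hv.1⟩, by omega⟩)
        ((card_subtree_le x _).trans (Nat.pow_le_pow_right (by omega) (by omega)))
      linarith
    -- Near the boundary no influence bound is available, but the whole subtree at x has at most L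
    -- levels and is itself a block.
    · have hTeq := desc_completeTree hx
      have a1 : Z x ≤ sqNorm β h V s₀ (fun s => f s - gibbsAvg β h (desc V x) f s) := by
        rw [hZ, siteVar, sqNorm_gibbsAvg_sub β h s₀ (erase_subset _ _) (desc_subset x),
          sqNorm_sub_gibbsAvg β h s₀ (desc_subset x)]
        have := sqNorm_gibbsAvg_le β h s₀ ((erase_subset x _).trans (desc_subset (V := V) x)) f
        linarith
      have a2 := block (desc V x) x (fun v hv => by
          refine mem_filter.2 ⟨hv, ?_⟩
          have := mem_completeTree.1 (mem_desc.1 hv).1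
          omega)
        (by
          rw [hTeq]
          exact (card_subtree_le x _).trans (Nat.pow_le_pow_right (by omega) (by omega)))
      have n1 : 0 ≤ ∑ y ∈ (desc V x).filter (fun y => y.length < x.length + (k + 2)), Z y :=
        sum_nonneg fun y _ => hZ0 y
      have n2 := a1.trans a2
      have n3 := mul_nonneg (mul_nonneg zero_le_two hε0) n1
      have n4 := (hZ0 x).trans n2
      linarith
  have total := sum_le_sum site
  rw [sum_add_distrib, ← mul_sum, ← mul_sum] at total
  have m1 := sum_desc_le (V := V) L hq0
  have m2 := sum_desc_le (V := V) (k + 2) hZ0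
  have hZsum : 0 ≤ ∑ y ∈ V, Z y := sum_nonneg fun y _ => hZ0 y
  have p1 := mul_le_mul_of_nonneg_left m1 (by positivity : 0 ≤ 2 * C)
  have p2 := mul_le_mul_of_nonneg_left m2 (by positivity : 0 ≤ 2 * decayRate b β κ k)
  have p3 := mul_le_mul_of_nonneg_right hk hZsum
  have hsum := sqNorm_sub_le_sum_siteVar β h s₀ (V := V) descClosed_empty descClosed_self
    (empty_subset _) f
  rw [gibbsAvg_empty, sdiff_empty, ← sqNorm_sub_gibbsAvg β h s₀ Subset.rfl] at hsum
  refine hsum.trans ?_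
  have fin : ∑ y ∈ V, Z y ≤ 4 * C * (L * ∑ y ∈ V, q y) := by linarith
  refine fin.trans (le_of_eq ?_)
  rw [poincareConst]
  ring

end

section

open Finset

variable {b : ℕ} {β : ℝ} (h : ℝ)

/-! ### The spectral gap in terms of single-site variances -/

/-- Extension of a function of Boolean configurations on `V` to functions of real spin values. -/
def extendFun {V : Finset (Vertex b)} (f : (V → Bool) → ℝ) (s : Vertex b → ℝ) : ℝ :=
  f fun v => decide (0 < s v)

lemma decide_spin_pos (t : Bool) : decide (0 < spin t) = t := by cases t <;> simp [spin]

lemma extendFun_spinValues {V : Finset (Vertex b)} (f : (V → Bool) → ℝ) (s : Vertex b → ℝ)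
    (ξ : V → Bool) : extendFun f (spinValues V s ξ) = f ξ := by
  unfold extendFun
  congr 1
  funext v
  rw [spinValues_of_mem v.2, decide_spin_pos]

variable {m : ℕ} (τ : Vertex b → SignType)

lemma expect_eq (f : (completeTree b m → Bool) → ℝ) : expect β h m τ f =
    gibbsAvg β h (completeTree b m) (extendFun f) fun v => (τ v : ℝ) := by
  rw [gibbsAvg_eq_sum, expect]
  simp only [extendFun_spinValues]

lemma variance_eq (f : (completeTree b m → Bool) → ℝ) : variance β h m τ f =
    sqNorm β h (completeTree b m) (fun v => (τ v : ℝ))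
      (fun s => extendFun f s - gibbsAvg β h (completeTree b m) (extendFun f) s) := by
  rw [sqNorm_sub_gibbsAvg β h _ Subset.rfl, variance, expect_eq, expect_eq]
  congr 1
  unfold sqNorm
  rw [gibbsAvg_of_dependsOn β h (A := completeTree b m)
    (g := fun s => gibbsAvg β h (completeTree b m) (extendFun f) s ^ 2)
    fun s s' hs => congrArg (· ^ 2) (gibbsAvg_dependsOn β h _ _ hs)]

lemma spinValues_singleton (x : Vertex b) (s : Vertex b → ℝ) (t : Bool) :
    spinValues {x} s (fun _ => t) = Function.update s x (spin t) := by
  funext v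
  by_cases e : v = x
  · subst e; rw [spinValues_of_mem (mem_singleton_self v), Function.update_self]
  · rw [spinValues_of_notMem (by simpa using e), Function.update_of_ne e]

lemma gibbs_singleton (x : Vertex b) (s : Vertex b → ℝ) (t : Bool) :
    gibbs β h {x} s (fun _ => t) = weight β h {x} (Function.update s x (spin t)) /
      (weight β h {x} (Function.update s x 1) + weight β h {x} (Function.update s x (-1))) := by
  rw [gibbs, spinValues_singleton]
  congr 1
  exact sumOver_singleton x (weight β h {x}) s

lemma spinValues_flip (x : completeTree b m) (σ : completeTree b m → Bool) (s : Vertex b → ℝ) :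
    spinValues (completeTree b m) s (flip σ x) =
      Function.update (spinValues (completeTree b m) s σ) x (spin (!σ x)) := by
  funext v
  by_cases e : v = x
  · subst e; rw [spinValues_of_mem x.2, flip, Function.update_self, Function.update_self]
  · rw [Function.update_of_ne e]
    by_cases hv : v ∈ completeTree b m
    · rw [spinValues_of_mem hv, spinValues_of_mem hv, flip, Function.update_of_ne]
      exact fun hc => e (congrArg Subtype.val hc)
    · rw [spinValues_of_notMem hv, spinValues_of_notMem hv]

/-- For a two-point law with masses p and q, the flip from either value contributes p q times the
squared jump, so the total is twice the variance; the 1/2 in the Dirichlet form compensates. -/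
lemma expect_flipRate (f : (completeTree b m → Bool) → ℝ) (x : completeTree b m) :
    expect β h m τ (fun σ => flipRate β h m τ x σ * (f (flip σ x) - f σ) ^ 2) =
      2 * sqNorm β h (completeTree b m) (fun v => (τ v : ℝ))
        (fun s => extendFun f s - gibbsAvg β h {x.1} (extendFun f) s) := by
  set F := extendFun f with hF
  set u : (Vertex b → ℝ) → ℝ := fun s =>
    gibbs β h {x.1} s (fun _ => !decide (0 < s x)) *
      (F (Function.update s x (spin (!decide (0 < s x)))) - F s) ^ 2 with hu
  have e1 : expect β h m τ (fun σ => flipRate β h m τ x σ * (f (flip σ x) - f σ) ^ 2) =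
      gibbsAvg β h (completeTree b m) u fun v => (τ v : ℝ) := by
    rw [gibbsAvg_eq_sum, expect]
    refine sum_congr rfl fun σ _ => ?_
    congr 1
    simp only [hu]
    rw [spinValues_of_mem x.2, decide_spin_pos, ← spinValues_flip, hF, extendFun_spinValues,
      extendFun_spinValues]
    rfl
  have hxV : {x.1} ⊆ completeTree b m := singleton_subset_iff.2 x.2
  rw [e1, ← gibbsAvg_gibbsAvg_of_subset β h hxV, sqNorm, ← gibbsAvg_smul]
  conv_rhs => rw [← gibbsAvg_gibbsAvg_of_subset β h hxV]
  congr 1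
  funext s
  rw [gibbsAvg_smul, gibbsAvg_sq_sub_self]
  simp only [gibbsAvg, sumOver_singleton, hu, gibbs_singleton, Function.update_self,
    Function.update_idem]
  have w1 := weight_pos β h {x.1} (Function.update s x 1)
  have w2 := weight_pos β h {x.1} (Function.update s x (-1))
  simp only [zero_lt_one, decide_true, Bool.not_true, spin, Left.neg_pos_iff, not_lt.2 zero_le_one,
    decide_false, Bool.not_false, if_true, Bool.false_eq_true, if_false]
  field_simp
  ring

lemma dirichletForm_eq (f : (completeTree b m → Bool) → ℝ) : dirichletForm β h m τ f =
    ∑ y ∈ completeTree b m, sqNorm β h (completeTree b m) (fun v => (τ v : ℝ))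
      (fun s => extendFun f s - gibbsAvg β h {y} (extendFun f) s) := by
  rw [dirichletForm]
  simp only [expect_flipRate]
  rw [← mul_sum, ← mul_assoc, one_div, inv_mul_cancel₀ two_ne_zero, one_mul, Finset.univ_eq_attach,
    sum_attach (completeTree b m) fun y => sqNorm β h (completeTree b m) (fun v => (τ v : ℝ))
      (fun s => extendFun f s - gibbsAvg β h {y} (extendFun f) s)]

lemma variance_pos {f : (completeTree b m → Bool) → ℝ} (hf : ∃ σ σ', f σ ≠ f σ') :
    0 < variance β h m τ f := by
  set s₀ : Vertex b → ℝ := fun v => (τ v : ℝ)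
  set M := gibbsAvg β h (completeTree b m) (extendFun f) s₀ with hM
  have e : variance β h m τ f = ∑ ξ, gibbs β h (completeTree b m) s₀ ξ * (f ξ - M) ^ 2 := by
    rw [variance_eq, sqNorm, gibbsAvg_sq_sub_self, gibbsAvg_eq_sum]
    simp only [extendFun_spinValues]
    rfl
  obtain ⟨σ, hσ⟩ : ∃ σ, f σ ≠ M := by
    obtain ⟨σ, σ', hne⟩ := hf
    by_contra hc
    push Not at hc
    exact hne ((hc σ).trans (hc σ').symm)
  rw [e]
  refine sum_pos' (fun ξ _ => mul_nonneg (gibbs_pos ..).le (sq_nonneg _)) ⟨σ, mem_univ _, ?_⟩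
  have := sub_ne_zero.2 hσ
  exact mul_pos (gibbs_pos ..) (by positivity)

theorem inv_le_spectralGap {C : ℝ} (hC : 0 < C)
    (H : ∀ f : (Vertex b → ℝ) → ℝ, sqNorm β h (completeTree b m) (fun v => (τ v : ℝ))
        (fun s => f s - gibbsAvg β h (completeTree b m) f s) ≤
      C * ∑ y ∈ completeTree b m, sqNorm β h (completeTree b m) (fun v => (τ v : ℝ))
        (fun s => f s - gibbsAvg β h {y} f s)) :
    C⁻¹ ≤ spectralGap β h m τ := by
  have hroot : ([] : Vertex b) ∈ completeTree b m := by simp [mem_completeTree]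
  -- Needed for the infimum: over an empty family the real infimum would take the default value 0.
  have : Nonempty {f : (completeTree b m → Bool) → ℝ // ∃ σ σ', f σ ≠ f σ'} :=
    ⟨⟨fun σ => if σ ⟨[], hroot⟩ then 1 else 0, fun _ => true, fun _ => false, by simp⟩⟩
  refine le_ciInf fun f => ?_
  have hv := variance_pos (β := β) h τ f.2
  rw [le_div_iff₀ hv, inv_mul_le_iff₀ hC, variance_eq, dirichletForm_eq]
  exact H _

/-- A uniform lower bound on the gap when influences are small at distance at least `ℓ₀` from
the boundary. -/
theorem exists_le_spectralGap (hβ : 0 ≤ β) {κ : ℝ} (hκ0 : 0 ≤ κ)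
    (hα : b * κ * Real.tanh β < 1) (ℓ₀ : ℕ) :
    ∃ c : ℝ, 0 < c ∧ ∀ (τ : Vertex b → SignType) (m : ℕ),
      (∀ y : Vertex b, y.length + ℓ₀ ≤ m →
        influence β (effectiveField β h (m - y.length) y fun v => (τ v : ℝ)) ≤ κ) →
      c ≤ spectralGap β h m τ := by
  have hα0 : 0 ≤ b * κ * Real.tanh β := by
    have := tanh_nonneg hβ
    positivity
  -- An exponential rate beats the linear factor k + 2, the number of levels over which a site
  -- variance is counted.
  obtain ⟨k, hk⟩ : ∃ k : ℕ, 2 * decayRate b β κ k * ((k + 2 : ℕ) : ℝ) ≤ 1 / 2 := by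
    have t1 := tendsto_self_mul_const_pow_of_lt_one hα0 hα
    have t2 := tendsto_pow_atTop_nhds_zero_of_lt_one hα0 hα
    have t3 := ((t1.add (t2.const_mul 2)).const_mul (2 * (b * κ * β)))
    simp only [mul_zero, add_zero] at t3
    obtain ⟨k, hk⟩ := (t3.eventually (ge_mem_nhds (by norm_num : (0 : ℝ) < 1 / 2))).exists
    refine ⟨k, le_trans (le_of_eq ?_) hk⟩
    rw [decayRate]
    push_cast
    ring
  have hC : 0 < poincareConst b β h (k + 1 + ℓ₀) := by
    have := blockConst_pos (b := b) β h ((b + 1) ^ (k + 1 + ℓ₀))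
    unfold poincareConst
    positivity
  refine ⟨_, inv_pos.2 hC, fun τ m hτ => inv_le_spectralGap h τ hC fun f => ?_⟩
  refine poincare h hβ (fun v => ?_) hκ0 hτ hk f
  cases τ v <;> simp

end

section

open Finset Filter Topology

variable {b : ℕ} {β : ℝ} (h : ℝ)

/-! ### Fixed points of the recursion -/

variable (b β) in
/-- The message from a tree of depth `k` with constant boundary value `e`. -/
def homMessage (e : ℝ) : ℕ → ℝ
  | 0 => β * e
  | k + 1 => edgeMessage β (β * h + b * homMessage e k)

variable (b β) in
/-- The effective field in a tree of depth `k` with constant boundary value `e`. -/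
def homField (e : ℝ) (k : ℕ) : ℝ := β * h + b * homMessage b β h e k

lemma message_const (e : ℝ) (k : ℕ) (x : Vertex b) :
    message β h k x (fun _ => e) = homMessage b β h e k := by
  induction k generalizing x with
  | zero => rfl
  | succ k ih => simp [message, homMessage, ih]

lemma effectiveField_const (e : ℝ) (k : ℕ) (x : Vertex b) :
    effectiveField β h k x (fun _ => e) = homField b β h e k := by
  simp [effectiveField, homField, message_const]

lemma edgeMessage_neg (a : ℝ) : edgeMessage β (-a) = -edgeMessage β a := by
  rw [edgeMessage, edgeMessage, Real.log_div (Real.cosh_pos _).ne' (Real.cosh_pos _).ne',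
    Real.log_div (Real.cosh_pos _).ne' (Real.cosh_pos _).ne', ← Real.cosh_neg (-a + β),
    ← Real.cosh_neg (-a - β)]
  ring_nf

lemma edgeMessage_lt (hβ : 0 < β) (a : ℝ) : edgeMessage β a < β := by
  have h2 := Real.cosh_pos (a - β)
  have key : Real.cosh (a + β) / Real.cosh (a - β) < Real.exp (2 * β) := by
    rw [div_lt_iff₀ h2, Real.cosh_eq, Real.cosh_eq, mul_div_assoc', mul_add, ← Real.exp_add,
      ← Real.exp_add]
    have : Real.exp (-(a + β)) < Real.exp (2 * β + -(a - β)) := Real.exp_lt_exp.2 (by linarith)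
    have e : 2 * β + (a - β) = a + β := by ring
    rw [e]
    linarith
  have := (Real.log_lt_iff_lt_exp (by have := Real.cosh_pos (a + β); positivity)).2 key
  rw [edgeMessage]
  linarith

lemma edgeMessage_le (hβ : 0 ≤ β) (a : ℝ) : edgeMessage β a ≤ β := by
  rcases hβ.eq_or_lt with rfl | hβ
  · simp [edgeMessage]
  · exact (edgeMessage_lt hβ a).le

lemma neg_le_edgeMessage (hβ : 0 ≤ β) (a : ℝ) : -β ≤ edgeMessage β a := by
  have := edgeMessage_le hβ (-a)
  rw [edgeMessage_neg] at this
  linarith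

lemma message_mem_Icc (hβ : 0 ≤ β) {s : Vertex b → ℝ} (hs : ∀ v, |s v| ≤ 1) (k : ℕ)
    (x : Vertex b) : message β h k x s ∈ Set.Icc (homMessage b β h (-1) k)
      (homMessage b β h 1 k) := by
  induction k generalizing x with
  | zero =>
    have := abs_le.1 (hs x)
    exact ⟨mul_le_mul_of_nonneg_left this.1 hβ, mul_le_mul_of_nonneg_left this.2 hβ⟩
  | succ k ih =>
    constructor
    · refine edgeMessage_monotone hβ (add_le_add_right ?_ _)
      simpa using sum_le_sum (s := (univ : Finset (Fin b))) fun i _ => (ih (i :: x)).1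
    · refine edgeMessage_monotone hβ (add_le_add_right ?_ _)
      simpa using sum_le_sum (s := (univ : Finset (Fin b))) fun i _ => (ih (i :: x)).2

lemma effectiveField_mem_Icc (hβ : 0 ≤ β) {s : Vertex b → ℝ} (hs : ∀ v, |s v| ≤ 1) (k : ℕ)
    (x : Vertex b) : effectiveField β h k x s ∈ Set.Icc (homField b β h (-1) k)
      (homField b β h 1 k) := by
  constructor
  · refine add_le_add_right ?_ _
    simpa using sum_le_sum (s := (univ : Finset (Fin b))) fun i _ => (message_mem_Icc h hβ hs k (i :: x)).1
  · refine add_le_add_right ?_ _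
    simpa using sum_le_sum (s := (univ : Finset (Fin b))) fun i _ => (message_mem_Icc h hβ hs k (i :: x)).2

lemma monotone_recursion (hβ : 0 ≤ β) : Monotone fun x => edgeMessage β (β * h + b * x) :=
  fun _ _ hxy => edgeMessage_monotone hβ (by gcongr)

/-- The boundary message β is the largest possible, so the first step goes down, and the monotone
recursion preserves this. -/
lemma homMessage_one_antitone (hβ : 0 ≤ β) : Antitone (homMessage b β h 1) := by
  refine antitone_nat_of_succ_le fun k => ?_
  induction k with
  | zero => simpa [homMessage] using edgeMessage_le hβ _
  | succ k ih => exact monotone_recursion h hβ ih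

lemma homMessage_neg_one_monotone (hβ : 0 ≤ β) : Monotone (homMessage b β h (-1)) := by
  refine monotone_nat_of_le_succ fun k => ?_
  induction k with
  | zero => simpa [homMessage] using neg_le_edgeMessage hβ _
  | succ k ih => exact monotone_recursion h hβ ih

lemma homMessage_mem_Icc (hβ : 0 ≤ β) {e : ℝ} (he : |e| ≤ 1) (k : ℕ) :
    homMessage b β h e k ∈ Set.Icc (-β) β := by
  cases k with
  | zero =>
    have := abs_le.1 he
    rw [homMessage]
    constructor <;> nlinarith
  | succ k => exact ⟨neg_le_edgeMessage hβ _, edgeMessage_le hβ _⟩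

lemma exists_tendsto_homField_neg_one (hβ : 0 ≤ β) :
    ∃ R, Tendsto (homField b β h (-1)) atTop (𝓝 R) := by
  have hb : BddAbove (Set.range (homMessage b β h (-1))) :=
    ⟨β, by rintro _ ⟨k, rfl⟩; exact (homMessage_mem_Icc h hβ (by simp) k).2⟩
  exact ⟨_, ((tendsto_atTop_ciSup (homMessage_neg_one_monotone h hβ) hb).const_mul _).const_add _⟩

/-- The plus effective fields converge to a fixed point where the slope of the recursion is at
most one. -/
theorem exists_tendsto_homField_one (hβ : 0 ≤ β) :
    ∃ R, Tendsto (homField b β h 1) atTop (𝓝 R) ∧ b * influence β R ≤ 1 := by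
  set u := homMessage b β h 1 with hu
  have hbd : BddBelow (Set.range u) :=
    ⟨-β, by rintro _ ⟨k, rfl⟩; exact (homMessage_mem_Icc h hβ (by simp) k).1⟩
  have hlim := tendsto_atTop_ciInf (homMessage_one_antitone h hβ) hbd
  set M := ⨅ k, u k with hM
  have hMle : ∀ k, M ≤ u k := fun k => ciInf_le hbd k
  refine ⟨β * h + b * M, (hlim.const_mul _).const_add _, ?_⟩
  have hder : HasDerivAt (fun x => edgeMessage β (β * h + b * x))
      (b * influence β (β * h + b * M)) M := by
    have h1 : HasDerivAt (fun x : ℝ => β * h + b * x) b M := by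
      simpa using ((hasDerivAt_id M).const_mul (b : ℝ)).const_add (β * h)
    have := (hasDerivAt_edgeMessage (β := β) (β * h + b * M)).comp M h1
    exact this.congr_deriv (mul_comm _ _)
  have hfix : edgeMessage β (β * h + b * M) = M := by
    have h1 := hder.continuousAt.tendsto.comp hlim
    have h2 : Tendsto (fun k => u (k + 1)) atTop (𝓝 M) := hlim.comp (tendsto_add_atTop_nat 1)
    exact tendsto_nhds_unique h1 h2
  -- If the slope exceeded 1, some x just above the limit M and below β would satisfy x ≤ G(x), with
  -- G the recursion map. Monotonicity would keep all iterates started from β above x, contradicting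
  -- convergence to M.
  by_contra hc
  push Not at hc
  have hβ0 : 0 < β := by
    rcases hβ.eq_or_lt with e | hβ0
    · rw [← e] at hc
      simp [influence] at hc
      linarith
    · exact hβ0
  have hMβ : M < β := hfix ▸ edgeMessage_lt hβ0 _
  have hslope := (hasDerivAt_iff_tendsto_slope.1 hder).eventually (lt_mem_nhds hc)
  have hslope' := hslope.filter_mono (nhdsWithin_mono M
    (s := Set.Ioi M) fun x hx => (Set.mem_Ioi.1 hx).ne')
  have hI : ∀ᶠ x in 𝓝[>] M, x ∈ Set.Ioo M β := Ioo_mem_nhdsGT hMβ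
  obtain ⟨x, hx1, hx2⟩ := (hslope'.and hI).exists
  have hGx : x ≤ edgeMessage β (β * h + b * x) := by
    rw [slope_def_field, hfix, lt_div_iff₀ (sub_pos.2 hx2.1)] at hx1
    linarith
  have hxu : ∀ k, x ≤ u k := by
    intro k
    induction k with
    | zero => simpa [hu, homMessage] using hx2.2.le
    | succ k ih => exact hGx.trans (monotone_recursion h hβ ih)
  exact absurd (le_ciInf hxu) (not_le.2 hx2.1)

/-- Near a fixed point with slope at most one, the influence is small. -/
lemma exists_influence_bound (hb : 2 ≤ b) (hβ : 0 ≤ β) {R : ℝ} (hR : b * influence β R ≤ 1) :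
    ∃ κ, 0 ≤ κ ∧ b * κ * Real.tanh β < 1 ∧ ∀ᶠ a in 𝓝 R, influence β a ≤ κ := by
  have hb0 : (0 : ℝ) < b := by exact_mod_cast (by omega : 0 < b)
  have ht0 := tanh_nonneg hβ
  have ht1 := Real.tanh_lt_one β
  have hin := influence_nonneg hβ R
  have hη : 0 < (1 - Real.tanh β) / (2 * b) := div_pos (by linarith) (by linarith)
  -- The margin is chosen so that, with t = tanh β, b κ t ≤ t + t (1 - t) / 2 < 1.
  refine ⟨influence β R + (1 - Real.tanh β) / (2 * b), by positivity, ?_, ?_⟩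
  · have e : b * (influence β R + (1 - Real.tanh β) / (2 * b)) =
        b * influence β R + (1 - Real.tanh β) / 2 := by field_simp
    rw [e]
    nlinarith
  · exact (continuous_influence.tendsto R).eventually (ge_mem_nhds (by linarith))

/-! ### The spectral gap in the three regimes -/

lemma mul_tanh_sq_lt_one (hb : 2 ≤ b) (h1 : β < betaOne b) (hβ : 0 ≤ β) :
    b * Real.tanh β * Real.tanh β < 1 := by
  have hb1 : (1 : ℝ) < √(b : ℝ) := by
    rw [Real.lt_sqrt zero_le_one]
    have : (2 : ℝ) ≤ b := by exact_mod_cast hb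
    linarith
  have hpos : 0 < (√(b : ℝ) + 1) / (√(b : ℝ) - 1) := div_pos (by linarith) (by linarith)
  have hE : Real.exp (2 * β) < (√(b : ℝ) + 1) / (√(b : ℝ) - 1) := by
    rw [← Real.lt_log_iff_exp_lt hpos]
    rw [betaOne] at h1
    linarith
  rw [lt_div_iff₀ (by linarith)] at hE
  have htanh : Real.tanh β = (Real.exp (2 * β) - 1) / (Real.exp (2 * β) + 1) := by
    have e : Real.exp (2 * β) = Real.exp β * Real.exp β := by rw [← Real.exp_add]; ring_nf
    rw [Real.tanh_eq, e, Real.exp_neg]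
    have := Real.exp_pos β
    field_simp
  have hEp := Real.exp_pos (2 * β)
  -- β₁ is exactly the value at which √b tanh β = 1.
  have hlt : √(b : ℝ) * Real.tanh β < 1 := by
    rw [htanh, mul_div_assoc', div_lt_one (by linarith)]
    linarith
  have h0 : 0 ≤ √(b : ℝ) * Real.tanh β := mul_nonneg (Real.sqrt_nonneg _) (tanh_nonneg hβ)
  have e : b * Real.tanh β * Real.tanh β = (√(b : ℝ) * Real.tanh β) ^ 2 := by
    rw [mul_pow, Real.sq_sqrt (Nat.cast_nonneg b)]; ring
  rw [e]
  exact pow_lt_one₀ h0 hlt two_ne_zero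

theorem exists_le_spectralGap_plus (hb : 2 ≤ b) (hβ : 0 ≤ β) :
    ∃ c : ℝ, 0 < c ∧ ∀ m : ℕ, c ≤ spectralGap β h m (fun _ : Vertex b => (1 : SignType)) := by
  obtain ⟨R, hR, hR1⟩ := exists_tendsto_homField_one (b := b) h hβ
  obtain ⟨κ, hκ0, hα, hκ⟩ := exists_influence_bound hb hβ hR1
  obtain ⟨ℓ₀, hℓ⟩ := eventually_atTop.1 (hR.eventually hκ)
  obtain ⟨c, hc, H⟩ := exists_le_spectralGap (b := b) h hβ hκ0 hα ℓ₀
  refine ⟨c, hc, fun m => H _ m fun y hy => ?_⟩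
  have e : (fun _ : Vertex b => ((1 : SignType) : ℝ)) = fun _ => 1 := by simp
  rw [e, effectiveField_const]
  exact hℓ _ (by omega)

theorem exists_le_spectralGap_of_lt_betaOne (hb : 2 ≤ b) (hβ : 0 ≤ β) (h1 : β < betaOne b) :
    ∃ c : ℝ, 0 < c ∧ ∀ (τ : Vertex b → SignType) (m : ℕ), c ≤ spectralGap β h m τ := by
  obtain ⟨c, hc, H⟩ := exists_le_spectralGap (b := b) h hβ (tanh_nonneg hβ)
    (mul_tanh_sq_lt_one hb h1 hβ) 0
  exact ⟨c, hc, fun τ m => H τ m fun y _ => influence_le_tanh hβ _⟩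

/-- By monotonicity the field of any boundary condition lies between the minus and plus ones. If
these share a limit, all fields far from the boundary are near the fixed point where the influence
is small. -/
theorem exists_le_spectralGap_of_tendsto (hb : 2 ≤ b) (hβ : 0 ≤ β)
    (H : ∀ R R', Tendsto (homField b β h 1) atTop (𝓝 R) →
      Tendsto (homField b β h (-1)) atTop (𝓝 R') → R = R') :
    ∃ c : ℝ, 0 < c ∧ ∀ (τ : Vertex b → SignType) (m : ℕ), c ≤ spectralGap β h m τ := by
  obtain ⟨R, hR, hR1⟩ := exists_tendsto_homField_one (b := b) h hβ
  obtain ⟨R', hR'⟩ := exists_tendsto_homField_neg_one (b := b) h hβ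
  obtain rfl := H R R' hR hR'
  obtain ⟨κ, hκ0, hα, hκ⟩ := exists_influence_bound hb hβ hR1
  obtain ⟨l, r, hlr, hsub⟩ := mem_nhds_iff_exists_Ioo_subset.1 hκ
  obtain ⟨ℓ₀, hℓ⟩ := eventually_atTop.1 ((hR'.eventually (lt_mem_nhds hlr.1)).and
    (hR.eventually (gt_mem_nhds hlr.2)))
  obtain ⟨c, hc, H⟩ := exists_le_spectralGap (b := b) h hβ hκ0 hα ℓ₀
  refine ⟨c, hc, fun τ m => H τ m fun y hy => ?_⟩
  have hmem := effectiveField_mem_Icc h hβ (s := fun v => (τ v : ℝ))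
    (fun v => by cases τ v <;> simp) (m - y.length) y
  have hk := hℓ (m - y.length) (by omega)
  exact hsub ⟨hk.1.trans_le hmem.1, hmem.2.trans_lt hk.2⟩

end

section

open Finset Filter Topology MeasureTheory
open scoped ENNReal NNReal BoundedContinuousFunction

variable {b : ℕ} (β h : ℝ)

/-! ### Infinite-volume Gibbs measures as limits of finite-volume ones -/

/-- A function of Boolean configurations as a function of real spin values. -/
def liftFun (φ : (Vertex b → Bool) → ℝ≥0) (s : Vertex b → ℝ) : ℝ := φ fun v => decide (0 < s v)

lemma spinValues_spin (A : Finset (Vertex b)) (ω : Vertex b → Bool) (ξ : A → Bool) :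
    spinValues A (fun v => spin (ω v)) ξ = fun v => spin (glue A ω ξ v) := by
  funext v
  by_cases hv : v ∈ A <;> simp [spinValues, glue, hv]

lemma liftFun_spin (φ : (Vertex b → Bool) → ℝ≥0) (ω : Vertex b → Bool) :
    liftFun φ (fun v => spin (ω v)) = φ ω := by
  simp only [liftFun, decide_spin_pos]

lemma lintegral_gibbsKernel (A : Finset (Vertex b)) (ω : Vertex b → Bool)
    {φ : (Vertex b → Bool) → ℝ≥0} (hφ : Measurable φ) :
    ∫⁻ ω', φ ω' ∂gibbsKernel β h A ω =
      ENNReal.ofReal (gibbsAvg β h A (liftFun φ) fun v => spin (ω v)) := by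
  rw [gibbsKernel, lintegral_finsetSum_measure, gibbsAvg_eq_sum, ENNReal.ofReal_sum_of_nonneg]
  · refine sum_congr rfl fun ξ _ => ?_
    rw [lintegral_smul_measure, lintegral_dirac' _ hφ.coe_nnreal_ennreal, spinValues_spin,
      liftFun_spin, ENNReal.ofReal_mul (gibbs_pos ..).le, ENNReal.ofReal_coe_nnreal, smul_eq_mul]
  · exact fun ξ _ => mul_nonneg (gibbs_pos ..).le (NNReal.coe_nonneg _)

instance isProbabilityMeasure_gibbsKernel (A : Finset (Vertex b)) (ω : Vertex b → Bool) :
    IsProbabilityMeasure (gibbsKernel β h A ω) := by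
  constructor
  have := lintegral_gibbsKernel β h A ω (φ := fun _ => 1) measurable_const
  have e : (liftFun fun _ : Vertex b → Bool => (1 : ℝ≥0)) = fun _ => 1 := by
    funext s; simp [liftFun]
  rw [e, gibbsAvg_const] at this
  simpa using this

lemma continuous_glue (A : Finset (Vertex b)) (ξ : A → Bool) :
    Continuous fun ω : Vertex b → Bool => glue A ω ξ := by
  refine continuous_pi fun v => ?_
  by_cases hv : v ∈ A
  · simp only [glue, hv, dite_true]; exact continuous_const
  · simp only [glue, hv, dite_false]; exact continuous_apply v

lemma continuous_weight (A : Finset (Vertex b)) : Continuous (weight β h A) := by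
  unfold weight
  fun_prop

lemma continuous_gibbs (A : Finset (Vertex b)) (ξ : A → Bool) :
    Continuous fun ω : Vertex b → Bool => gibbs β h A (fun v => spin (ω v)) ξ := by
  have hc : ∀ ζ : A → Bool, Continuous fun ω : Vertex b → Bool =>
      weight β h A (spinValues A (fun v => spin (ω v)) ζ) := fun ζ => by
    simp only [spinValues_spin]
    refine (continuous_weight β h A).comp (continuous_pi fun v => ?_)
    exact (continuous_of_discreteTopology (f := spin)).comp
      ((continuous_apply v).comp (continuous_glue A ζ))
  exact (hc ξ).div (continuous_finsetSum _ fun ζ _ => hc ζ)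
    fun ω => (Finset.sum_pos (fun _ _ => weight_pos ..) univ_nonempty).ne'

lemma measurable_gibbsKernel (A : Finset (Vertex b)) : Measurable (gibbsKernel (b := b) β h A) := by
  refine Measure.measurable_of_measurable_coe _ fun s hs => ?_
  simp only [gibbsKernel, Measure.coe_finsetSum, Finset.sum_apply, Measure.smul_apply, smul_eq_mul]
  refine Finset.measurable_sum _ fun ξ _ => ?_
  refine (ENNReal.measurable_ofReal.comp (continuous_gibbs β h A ξ).measurable).mul ?_
  exact (Measure.measurable_coe hs).comp
    (Measure.measurable_dirac.comp (continuous_glue A ξ).measurable)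

/-- The average of a continuous function under the Gibbs kernel. -/
def kernelAvg (A : Finset (Vertex b)) (φ : (Vertex b → Bool) →ᵇ ℝ≥0) :
    (Vertex b → Bool) →ᵇ ℝ≥0 :=
  BoundedContinuousFunction.mkOfCompact
    ⟨fun ω => ∑ ξ : A → Bool, (gibbs β h A (fun v => spin (ω v)) ξ).toNNReal * φ (glue A ω ξ),
      continuous_finsetSum _ fun ξ _ => (continuous_real_toNNReal.comp
        (continuous_gibbs β h A ξ)).mul (φ.continuous.comp (continuous_glue A ξ))⟩

lemma coe_kernelAvg (A : Finset (Vertex b)) (φ : (Vertex b → Bool) →ᵇ ℝ≥0)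
    (ω : Vertex b → Bool) : (kernelAvg β h A φ ω : ℝ) =
      gibbsAvg β h A (liftFun φ) fun v => spin (ω v) := by
  rw [gibbsAvg_eq_sum]
  simp only [kernelAvg, BoundedContinuousFunction.mkOfCompact_apply, ContinuousMap.coe_mk,
    NNReal.coe_sum, NNReal.coe_mul]
  refine sum_congr rfl fun ξ _ => ?_
  rw [Real.coe_toNNReal _ (gibbs_pos ..).le, spinValues_spin, liftFun_spin]

lemma lintegral_gibbsKernel_eq_kernelAvg (A : Finset (Vertex b)) (φ : (Vertex b → Bool) →ᵇ ℝ≥0)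
    (ω : Vertex b → Bool) : ∫⁻ ω', φ ω' ∂gibbsKernel β h A ω = kernelAvg β h A φ ω := by
  rw [lintegral_gibbsKernel β h A ω φ.continuous.measurable, ← coe_kernelAvg,
    ENNReal.ofReal_coe_nnreal]

/-- Consistency of the specification, tested on continuous functions, the form in which it passes to
weak limits. -/
lemma lintegral_kernelAvg {A V : Finset (Vertex b)} (hAV : A ⊆ V)
    (φ : (Vertex b → Bool) →ᵇ ℝ≥0) (ω : Vertex b → Bool) :
    ∫⁻ ω', kernelAvg β h A φ ω' ∂gibbsKernel β h V ω = ∫⁻ ω', φ ω' ∂gibbsKernel β h V ω := by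
  rw [lintegral_gibbsKernel β h V ω φ.continuous.measurable,
    lintegral_gibbsKernel β h V ω (kernelAvg β h A φ).continuous.measurable,
    ← gibbsAvg_gibbsAvg_of_subset β h hAV (liftFun φ)]
  congr 1
  refine gibbsAvg_congr_on β h fun ξ => ?_
  rw [spinValues_spin, liftFun_spin, coe_kernelAvg]

lemma exists_completeTree_superset (A : Finset (Vertex b)) :
    ∃ M, ∀ m ≥ M, A ⊆ completeTree b m := by
  refine ⟨A.sup List.length, fun m hm v hv => ?_⟩
  rw [mem_completeTree]
  exact (Finset.le_sup (f := List.length) hv).trans hm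

/-- Every cluster point of the finite-volume Gibbs measures is an infinite-volume one. -/
theorem exists_mem_gibbsMeasures (ω : Vertex b → Bool) {p : ℝ≥0}
    (hp : Tendsto (fun m => gibbsKernel β h (completeTree b m) ω {ω' | ω' [] = true}) atTop
      (𝓝 (p : ℝ≥0∞))) :
    ∃ ν ∈ gibbsMeasures b β h, ν {ω' | ω' [] = true} = p := by
  set μ : ℕ → ProbabilityMeasure (Vertex b → Bool) := fun m =>
    ⟨gibbsKernel β h (completeTree b m) ω, inferInstance⟩ with hμ
  -- The space of probability measures on this compact space is compact, so an ultrafilter gives a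
  -- limit without extracting subsequences.
  set U : Ultrafilter ℕ := Ultrafilter.of atTop with hU
  have hUle : (U : Filter ℕ) ≤ atTop := Ultrafilter.of_le atTop
  set ν := (U.map μ).lim with hν
  have hlim : Tendsto μ U (𝓝 ν) := (U.map μ).le_nhds_lim
  have hint := ProbabilityMeasure.tendsto_iff_forall_lintegral_tendsto.1 hlim
  refine ⟨ν, ⟨inferInstance, fun A E hE => ?_⟩, ?_⟩
  · have hmeas := measurable_gibbsKernel (b := b) β h A
    have hbind : (ν : Measure (Vertex b → Bool)).bind (gibbsKernel β h A) = ν := by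
      symm
      refine ext_of_forall_lintegral_eq_of_IsFiniteMeasure fun φ => ?_
      rw [Measure.lintegral_bind hmeas.aemeasurable
        φ.continuous.measurable.coe_nnreal_ennreal.aemeasurable]
      simp only [lintegral_gibbsKernel_eq_kernelAvg]
      refine tendsto_nhds_unique (hint φ) ((hint (kernelAvg β h A φ)).congr' ?_)
      obtain ⟨M, hM⟩ := exists_completeTree_superset A
      filter_upwards [hUle (eventually_ge_atTop M)] with m hm
      exact lintegral_kernelAvg β h (hM m hm) φ ω
    rw [← Measure.bind_apply hE hmeas.aemeasurable, hbind]
  -- The event depends on one coordinate and is clopen, so weak convergence gives convergence of its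
  -- probability.
  · have hclopen : IsClopen {ω' : Vertex b → Bool | ω' [] = true} :=
      (isClopen_discrete {true}).preimage (continuous_apply [])
    have h1 := ProbabilityMeasure.tendsto_measure_of_isClopen_of_tendsto hlim hclopen
    have h2 := (ENNReal.continuous_coe.tendsto _).comp h1
    have h3 := tendsto_nhds_unique (h2.congr fun m => by
      simp only [Function.comp, ProbabilityMeasure.ennreal_coeFn_eq_coeFn_toMeasure]
      rfl) (hp.mono_left hUle)
    rwa [ProbabilityMeasure.ennreal_coeFn_eq_coeFn_toMeasure] at h3

/-! ### From uniqueness of the Gibbs measure to equality of the limiting fields -/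

lemma gibbsKernel_root (m : ℕ) (t : Bool) :
    gibbsKernel β h (completeTree b m) (fun _ => t) {ω' | ω' [] = true} =
      ENNReal.ofReal ((1 + Real.tanh (homField b β h (spin t) m)) / 2) := by
  classical
  set φ : (Vertex b → Bool) → ℝ≥0 := fun ω' => if ω' [] = true then 1 else 0 with hφ
  have hset : MeasurableSet {ω' : Vertex b → Bool | ω' [] = true} :=
    measurableSet_eq_fun (measurable_pi_apply []) measurable_const
  have hmeas : Measurable φ := Measurable.ite hset measurable_const measurable_const
  have h1 := lintegral_gibbsKernel β h (completeTree b m) (fun _ => t) hmeas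
  have e1 : ∀ ω' : Vertex b → Bool, (φ ω' : ℝ≥0∞) =
      ({ω' | ω' [] = true} : Set (Vertex b → Bool)).indicator 1 ω' := fun ω' => by
    by_cases hω : ω' [] = true <;> simp [hφ, hω]
  simp only [e1] at h1
  rw [lintegral_indicator_one hset] at h1
  rw [h1, completeTree_eq_subtree, gibbsAvg_subtree, effectiveField_const]
  · congr 1
    simp [liftFun, hφ, parentSpin, not_lt.2 (zero_le_one (α := ℝ))]
    ring
  · intro s s' hs
    simp only [liftFun, hφ, hs [] (by simp)]

/-- The plus and minus limits have root marginals (1 + tanh R) / 2 and (1 + tanh R') / 2. If the two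
measures coincide, injectivity of tanh gives equal fields. -/
theorem tendsto_unique_of_not_nontrivial (H : ¬(gibbsMeasures b β h).Nontrivial) {R R' : ℝ}
    (hR : Tendsto (homField b β h 1) atTop (𝓝 R))
    (hR' : Tendsto (homField b β h (-1)) atTop (𝓝 R')) : R = R' := by
  have htanh : Continuous Real.tanh := by
    have e : Real.tanh = fun x => Real.sinh x / Real.cosh x :=
      funext Real.tanh_eq_sinh_div_cosh
    rw [e]
    exact Real.continuous_sinh.div Real.continuous_cosh fun x => (Real.cosh_pos x).ne'
  have key : ∀ (t : Bool) {R : ℝ}, Tendsto (homField b β h (spin t)) atTop (𝓝 R) →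
      ∃ ν ∈ gibbsMeasures b β h, ν {ω' | ω' [] = true} =
        ENNReal.ofReal ((1 + Real.tanh R) / 2) := by
    intro t R hR
    refine exists_mem_gibbsMeasures β h (fun _ => t)
      (p := ((1 + Real.tanh R) / 2).toNNReal) ?_
    simp only [gibbsKernel_root]
    refine (ENNReal.continuous_ofReal.tendsto _).comp ?_
    exact (((htanh.tendsto R).comp hR).const_add 1).div_const 2
  obtain ⟨ν, hν, e⟩ := key true (R := R) (by simpa [spin] using hR)
  obtain ⟨ν', hν', e'⟩ := key false (R := R') (by simpa [spin] using hR')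
  have hsub := Set.not_nontrivial_iff.1 H hν hν'
  rw [hsub, e'] at e
  have p1 := Real.neg_one_lt_tanh R
  have p2 := Real.neg_one_lt_tanh R'
  rw [ENNReal.ofReal_eq_ofReal_iff (by linarith) (by linarith)] at e
  exact Real.tanh_injective (by linarith)

theorem not_nontrivial_of_criticalField_lt (H : criticalField b β < ENNReal.ofReal |h|) :
    ¬(gibbsMeasures b β h).Nontrivial := fun hc =>
  absurd (le_iSup₂ (f := fun (h : ℝ) (_ : (gibbsMeasures b β h).Nontrivial) =>
    ENNReal.ofReal |h|) h hc) (not_le.2 H)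

end

end IsingTree

end

theorem theorem1 (b : ℕ) (hb : 2 ≤ b) (β h : ℝ) (hβ : 0 ≤ β) :
    (β < IsingTree.betaOne b ∨ IsingTree.criticalField b β < ENNReal.ofReal |h| →
      ∃ c : ℝ, 0 < c ∧ ∀ (τ : IsingTree.Vertex b → SignType) (m : ℕ),
        c ≤ IsingTree.spectralGap β h m τ) ∧
    (∃ c : ℝ, 0 < c ∧ ∀ m : ℕ,
        c ≤ IsingTree.spectralGap β h m (fun _ : IsingTree.Vertex b => (1 : SignType))) := by
  refine ⟨?_, IsingTree.exists_le_spectralGap_plus h hb hβ⟩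
  rintro (h1 | h1)
  · exact IsingTree.exists_le_spectralGap_of_lt_betaOne h hb hβ h1
  · exact IsingTree.exists_le_spectralGap_of_tendsto h hb hβ fun _ _ hR hR' =>
      IsingTree.tendsto_unique_of_not_nontrivial β h
        (IsingTree.not_nontrivial_of_criticalField_lt β h h1) hR hR'
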